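/- Let $m\ge 2$ and $\ell\ge 1$ be integers and let $q_1,\dots,q_\ell$ be functions from the positive integers to the positive integers with $q_1(k)=k$ for all $k\ge1$, such that for some $0<\varepsilon\le 1$ and all $n\ge 1$: $q_i(n)\ge q_{i-1}(n)+\varepsilon n$ for $2\le i\le \ell$, and $q_i(n+1)\ge q_i(n)+\varepsilon$ for $1\le i\le\ell$. For $x\in(0,1)$ let $x=\sum_{i\ge1}a_{i-1}(x)m^{-i}$, $a_j(x)\in\{0,\dots,m-1\}$, be the base-$m$ expansion which does not end in a tail of digits $m-1$. Put $\mathcal A_\ell=\{0,\dots,m-1\}^\ell$ and for $\alpha,\beta\in\mathcal A_\ell$ let $$N_{\alpha,\beta}(x,n)=\#\{1\le k\le n:\ (a_{q_1(k)}(x),\dots,a_{q_\ell(k)}(x))=\alpha,\ (a_{q_1(k)+1}(x),\dots,a_{q_\ell(k)+1}(x))=\beta\}.$$ For a matrix $P=(p_{\alpha\beta})_{\alpha,\beta\in\mathcal A_\ell}$ let $$U_P=\{x\in(0,1):\ \lim_{n\to\infty}\tfrac1nN_{\alpha,\beta}(x,n)=p_{\alpha\beta}\ \text{ for all }\alpha,\beta\in\mathcal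 A_\ell\}.$$ **Proposition 2.7.** Let $R=(r_{ij})_{i,j=0}^{m-1}$ be a nonnegative matrix such that (i) some power $R^n$, $n\ge1$, has only positive entries; (ii) $\sum_{i,j}r_{ij}=1$ and $q_i:=\sum_{j}r_{ij}=\sum_{j}r_{ji}$ for every $i$; (iii) $p_{\alpha\beta}=\prod_{i=1}^{\ell}r_{\alpha_i\beta_i}$ for all $\alpha,\beta\in\mathcal A_\ell$. Then all $q_i$ are positive, the matrix $Q=(q_{ij})$, $q_{ij}=q_i^{-1}r_{ij}$, is an irreducible aperiodic probability (row-stochastic) matrix, and $q=(q_0,\dots,q_{m-1})$ is its unique stationary probability vector. Moreover, with the convention $0\ln0=0$, the Hausdorff dimension of $U_P$ is $$HD(U_P)=\frac{-\sum_{i,j=0}^{m-1}q_iq_{ij}\ln q_{ij}}{\ln m}.$$ -/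

import Mathlib

open Filter Topology

/-- Sampling times `τ 0 n < τ 1 n < ⋯ < τ (ℓ - 1) n`, given at the positive integers `n`: positive
integers such that for some `0 < ε ≤ 1` consecutive times satisfy `τ (i + 1) n ≥ τ i n + ε n`, and
each of them satisfies `τ i (n + 1) ≥ τ i n + ε`. -/
def IsSamplingFamily {ℓ : ℕ} (τ : Fin ℓ → ℕ → ℕ) : Prop :=
  (∀ i, ∀ n, 1 ≤ n → 0 < τ i n) ∧
  ∃ ε : ℝ, 0 < ε ∧ ε ≤ 1 ∧
    (∀ i j : Fin ℓ, (i : ℕ) + 1 = j → ∀ n : ℕ, 1 ≤ n → (τ i n : ℝ) + ε * n ≤ τ j n) ∧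
    (∀ i : Fin ℓ, ∀ n : ℕ, 1 ≤ n → (τ i n : ℝ) + ε ≤ τ i (n + 1))

/-- The number of `k` with `1 ≤ k ≤ n` such that the base-`m` digits of `x` read `α` at the places
`τ i k` and `β` at the places `τ i k + 1`. The digits `Real.digits x m` are numbered from `0`, and
for `x` in `[0, 1)` they never end in a tail of digits `m - 1`. -/
noncomputable def pairCount {m ℓ : ℕ} [NeZero m] (τ : Fin ℓ → ℕ → ℕ) (α β : Fin ℓ → Fin m)
    (x : ℝ) (n : ℕ) : ℕ :=
  ((Finset.Icc 1 n).filter fun k =>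
    (fun i => Real.digits x m (τ i k)) = α ∧ (fun i => Real.digits x m (τ i k + 1)) = β).card

/-- The numbers in `(0, 1)` whose consecutive pairs of words along `τ` have frequencies `P`. -/
def prescribedFrequencySet {m ℓ : ℕ} [NeZero m] (τ : Fin ℓ → ℕ → ℕ)
    (P : Matrix (Fin ℓ → Fin m) (Fin ℓ → Fin m) ℝ) : Set ℝ :=
  {x | x ∈ Set.Ioo (0 : ℝ) 1 ∧ ∀ α β : Fin ℓ → Fin m,
    Tendsto (fun n : ℕ => (pairCount τ α β x n : ℝ) / n) atTop (𝓝 (P α β))}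

/-- Aperiodicity of a nonnegative square matrix: for every index `i`, the greatest common divisor
of the return times `{n ≥ 1 : (Aⁿ)ᵢᵢ > 0}` is `1`. -/
def IsAperiodicMatrix {ι : Type*} [Fintype ι] [DecidableEq ι] (A : Matrix ι ι ℝ) : Prop :=
  ∀ i, ∀ d : ℕ, (∀ n : ℕ, 1 ≤ n → 0 < (A ^ n) i i → d ∣ n) → d = 1

open MeasureTheory ProbabilityTheory
open scoped NNReal ENNReal

/-! Let the digits be random, namely a Markov chain with transition matrix `Q` and initial law `q`.
The cylinder of a word `a` then has mass `q (a 0)` times a product of the entries `Q (a i) (a (i +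
1))`. Since the first sampling time is `k` itself, summing the product frequencies over the other
coordinates shows that every `x` in the set has digit-pair frequencies `q i * Q i j`. So if no entry
of `Q` vanishes, the logarithm of the mass of the `n`-th cylinder around `x`, divided by `n`, tends
to minus the entropy, and Billingsley's lemma turns this exponent into a dimension.

The lower bound also needs the set to carry the chain. This is a nonconventional law of large
numbers: the sampling times separate linearly and `Q` mixes geometrically, so the transition seen at
the last time is almost uncorrelated with those seen at the earlier ones; induction on `ℓ` gives the
product frequencies almost surely.

For the upper bound `Q` may vanish on transitions that a point of the set uses with frequency zero.
Hence `Q` is mixed with a little of the uniform matrix, which makes every cylinder charged at an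
arbitrarily small cost in the exponent. There the measure need not live on the set. -/

/-! ### Primitive stochastic matrices -/

/-- A stochastic matrix some power of which is positive converges geometrically to its stationary
distribution. -/
theorem exists_geometric_mixing {ι : Type*} [Fintype ι] [DecidableEq ι]
    {Q : Matrix ι ι ℝ} (hQ : Q ∈ Matrix.rowStochastic ℝ ι) {q : ι → ℝ} (hq : ∀ i, 0 ≤ q i)
    (hq1 : ∑ i, q i = 1) (hqQ : Matrix.vecMul q Q = q) {N : ℕ} (hN : 1 ≤ N)
    (hpos : ∀ i j, 0 < (Q ^ N) i j) :
    ∃ C ρ : ℝ, 0 < C ∧ 0 < ρ ∧ ρ < 1 ∧ ∀ d i j, |(Q ^ d) i j - q j| ≤ C * ρ ^ d := by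
  have hne : Nonempty ι := by
    by_contra h
    rw [not_nonempty_iff] at h
    simp at hq1
  have hQd : ∀ d, Q ^ d ∈ Matrix.rowStochastic ℝ ι := fun d => pow_mem hQ d
  have hstat : ∀ d, Matrix.vecMul q (Q ^ d) = q := by
    intro d
    induction d with
    | zero => simp
    | succ d ih => rw [pow_succ, ← Matrix.vecMul_vecMul, ih, hqQ]
  have hq_le : ∀ i, q i ≤ 1 := fun i => by
    rw [← hq1]; exact Finset.single_le_sum (fun j _ => hq j) (Finset.mem_univ i)
  -- Halving the least entry keeps `δ < 1` even for a single state.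
  obtain ⟨δ, hδ0, hδ1, hδ⟩ : ∃ δ : ℝ, 0 < δ ∧ δ < 1 ∧ ∀ i j, δ ≤ (Q ^ N) i j := by
    obtain ⟨p, hp⟩ := Finite.exists_min fun p : ι × ι => (Q ^ N) p.1 p.2
    refine ⟨(Q ^ N) p.1 p.2 / 2, by linarith [hpos p.1 p.2], ?_, fun i j => ?_⟩
    · linarith [Matrix.le_one_of_mem_rowStochastic (hQd N) (i := p.1) (j := p.2)]
    · linarith [hp (i, j), hpos p.1 p.2]
  -- Doeblin's argument: by stationarity, subtracting `δ * q l` from the weights `(Q ^ N) i l` does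
  -- not change the deviation from `q j`. The new weights are nonnegative of total mass `1 - δ`, so
  -- each block of `N` steps contracts by that factor.
  have key : ∀ k d i j, |(Q ^ (N * k + d)) i j - q j| ≤ (1 - δ) ^ k := by
    intro k
    induction k with
    | zero =>
      intro d i j
      have h1 := Matrix.le_one_of_mem_rowStochastic (hQd d) (i := i) (j := j)
      have h0 := Matrix.nonneg_of_mem_rowStochastic (hQd d) (i := i) (j := j)
      have := hq j
      have := hq_le j
      simp only [mul_zero, zero_add, pow_zero]
      rw [abs_le]; constructor <;> linarith
    | succ k ih =>
      intro d i j
      have e : Q ^ (N * (k + 1) + d) = Q ^ N * Q ^ (N * k + d) := by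
        rw [← pow_add]; congr 1; ring
      have h0 : ∑ l, q l * ((Q ^ (N * k + d)) l j - q j) = 0 := by
        have := congrFun (hstat (N * k + d)) j
        simp only [Matrix.vecMul, dotProduct] at this
        simp only [mul_sub, Finset.sum_sub_distrib, this, ← Finset.sum_mul, hq1]
        ring
      have h1 : (Q ^ (N * (k + 1) + d)) i j - q j =
          ∑ l, ((Q ^ N) i l - δ * q l) * ((Q ^ (N * k + d)) l j - q j) := by
        have : ∑ l, ((Q ^ N) i l - δ * q l) * ((Q ^ (N * k + d)) l j - q j) =
            ∑ l, (Q ^ N) i l * ((Q ^ (N * k + d)) l j - q j) -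
              δ * ∑ l, q l * ((Q ^ (N * k + d)) l j - q j) := by
          rw [Finset.mul_sum, ← Finset.sum_sub_distrib]
          exact Finset.sum_congr rfl fun l _ => by ring
        rw [this, h0, e, Matrix.mul_apply]
        simp only [mul_sub, Finset.sum_sub_distrib, ← Finset.sum_mul,
          Matrix.sum_row_of_mem_rowStochastic (hQd N)]
        ring
      rw [h1]
      calc |∑ l, ((Q ^ N) i l - δ * q l) * ((Q ^ (N * k + d)) l j - q j)|
          ≤ ∑ l, ((Q ^ N) i l - δ * q l) * (1 - δ) ^ k := by
            refine (Finset.abs_sum_le_sum_abs _ _).trans (Finset.sum_le_sum fun l _ => ?_)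
            have hnn : 0 ≤ (Q ^ N) i l - δ * q l := by
              nlinarith [hδ i l, hq_le l, hq l]
            rw [abs_mul, abs_of_nonneg hnn]
            exact mul_le_mul_of_nonneg_left (ih d l j) hnn
        _ = (1 - δ) ^ (k + 1) := by
            rw [← Finset.sum_mul, Finset.sum_sub_distrib, ← Finset.mul_sum, hq1,
              Matrix.sum_row_of_mem_rowStochastic (hQd N)]
            ring
  have h1δ : 0 < 1 - δ := by linarith
  have hN0 : N ≠ 0 := by lia
  -- The rate is spread over the `N` steps of a block; the constant pays for the incomplete block `d
  -- % N`.
  refine ⟨(1 - δ)⁻¹, (1 - δ) ^ ((N : ℝ)⁻¹), by positivity, by positivity,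
    Real.rpow_lt_one h1δ.le (by linarith) (by positivity), fun d i j => ?_⟩
  have hρ : ((1 - δ) ^ ((N : ℝ)⁻¹)) ^ N = 1 - δ := Real.rpow_inv_natCast_pow h1δ.le hN0
  set ρ := (1 - δ) ^ ((N : ℝ)⁻¹) with hρdef
  have hρ0 : 0 < ρ := by positivity
  have hρ1 : ρ ≤ 1 := (Real.rpow_lt_one h1δ.le (by linarith) (by positivity)).le
  have hd := key (d / N) (d % N) i j
  rw [Nat.div_add_mod] at hd
  refine hd.trans ?_
  rw [inv_mul_eq_div, le_div_iff₀ h1δ, ← pow_succ]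
  nth_rewrite 1 [← hρ]
  rw [← pow_mul]
  refine pow_le_pow_of_le_one hρ0.le hρ1 ?_
  exact (Nat.lt_mul_div_succ d (by lia)).le

theorem eq_of_geometric_mixing {ι : Type*} [Fintype ι] [DecidableEq ι] {Q : Matrix ι ι ℝ}
    {q : ι → ℝ} {C ρ : ℝ} (hρ0 : 0 < ρ) (hρ1 : ρ < 1)
    (hmix : ∀ d i j, |(Q ^ d) i j - q j| ≤ C * ρ ^ d)
    {v : ι → ℝ} (hv1 : ∑ i, v i = 1) (hvQ : Matrix.vecMul v Q = v) : v = q := by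
  have hstat : ∀ d, Matrix.vecMul v (Q ^ d) = v := by
    intro d
    induction d with
    | zero => simp
    | succ d ih => rw [pow_succ, ← Matrix.vecMul_vecMul, ih, hvQ]
  have hlim : ∀ i j, Tendsto (fun d => (Q ^ d) i j) atTop (𝓝 (q j)) := by
    intro i j
    rw [tendsto_iff_norm_sub_tendsto_zero]
    refine squeeze_zero (fun _ => norm_nonneg _) (fun d => hmix d i j) ?_
    simpa using (tendsto_pow_atTop_nhds_zero_of_lt_one hρ0.le hρ1).const_mul C
  funext j
  have h1 : Tendsto (fun d => ∑ i, v i * (Q ^ d) i j) atTop (𝓝 (∑ i, v i * q j)) :=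
    tendsto_finsetSum _ fun i _ => (hlim i j).const_mul _
  have h2 : (fun d => ∑ i, v i * (Q ^ d) i j) = fun _ => v j := by
    funext d
    exact congrFun (hstat d) j
  rw [h2, ← Finset.sum_mul, hv1, one_mul] at h1
  exact tendsto_nhds_unique tendsto_const_nhds h1

/-- Rows of `Q` are nonzero, so `Q ^ (N + 1)` also has positive diagonal; `N` and `N + 1` are
coprime return times. -/
theorem isAperiodicMatrix_of_pow_pos {ι : Type*} [Fintype ι] [DecidableEq ι] {Q : Matrix ι ι ℝ}
    (hQ : Q ∈ Matrix.rowStochastic ℝ ι) {N : ℕ} (hN : 1 ≤ N) (hpos : ∀ i j, 0 < (Q ^ N) i j) :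
    IsAperiodicMatrix Q := by
  intro i d hd
  have h1 : 0 < (Q ^ (N + 1)) i i := by
    rw [pow_succ', Matrix.mul_apply]
    have hnn : ∀ l ∈ Finset.univ, 0 ≤ Q i l * (Q ^ N) l i := fun l _ =>
      mul_nonneg (Matrix.nonneg_of_mem_rowStochastic hQ) (hpos l i).le
    refine (Finset.sum_nonneg hnn).lt_of_ne fun h => ?_
    have h0 := (Finset.sum_eq_zero_iff_of_nonneg hnn).1 h.symm
    have hsum := Matrix.sum_row_of_mem_rowStochastic hQ i
    rw [Finset.sum_eq_zero fun l hl => (mul_eq_zero.1 (h0 l hl)).resolve_right (hpos l i).ne'] at hsum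
    exact zero_ne_one hsum
  have := (Nat.dvd_add_right (hd N hN (hpos i i))).1 (hd (N + 1) (by lia) h1)
  exact Nat.dvd_one.1 this

theorem pow_apply_le_pow_apply {ι : Type*} [Fintype ι] [DecidableEq ι] {A B : Matrix ι ι ℝ}
    (hA : ∀ i j, 0 ≤ A i j) (hAB : ∀ i j, A i j ≤ B i j) (n : ℕ) (i j : ι) :
    0 ≤ (A ^ n) i j ∧ (A ^ n) i j ≤ (B ^ n) i j := by
  induction n generalizing i j with
  | zero => by_cases h : i = j <;> simp [h]
  | succ n ih =>
    simp only [pow_succ, Matrix.mul_apply]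
    exact ⟨Finset.sum_nonneg fun l _ => mul_nonneg (ih i l).1 (hA l j),
      Finset.sum_le_sum fun l _ => mul_le_mul (ih i l).2 (hAB l j) (hA l j)
        ((ih i l).1.trans (ih i l).2)⟩

theorem sum_row_pos_of_pow_pos {ι : Type*} [Fintype ι] [DecidableEq ι] {R : Matrix ι ι ℝ}
    (hR : ∀ i j, 0 ≤ R i j) {N : ℕ} (hN : 1 ≤ N) (hpos : ∀ i j, 0 < (R ^ N) i j) (i : ι) :
    0 < ∑ j, R i j := by
  refine (Finset.sum_nonneg fun j _ => hR i j).lt_of_ne fun h => ?_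
  have h0 := (Finset.sum_eq_zero_iff_of_nonneg fun j _ => hR i j).1 h.symm
  obtain ⟨M, rfl⟩ : ∃ M, N = M + 1 := ⟨N - 1, by lia⟩
  have := hpos i i
  rw [pow_succ', Matrix.mul_apply, Finset.sum_eq_zero fun l hl => by rw [h0 l hl, zero_mul]] at this
  exact lt_irrefl _ this

/-! ### Construction of the Markov chain -/

/-- `X` is a Markov chain adapted to `F` with transition matrix `Q` and initial distribution `q`. -/
structure IsMarkovChain {ι Ω : Type*} [DecidableEq ι] [MeasurableSpace ι] [mΩ : MeasurableSpace Ω]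
    (μ : Measure Ω) (F : Filtration ℕ mΩ) (X : ℕ → Ω → ι) (Q : Matrix ι ι ℝ) (q : ι → ℝ) :
    Prop where
  adapted : ∀ n, Measurable[F n] (X n)
  initial : ∀ a, ∫ ω, (if X 0 ω = a then 1 else 0 : ℝ) ∂μ = q a
  transition : ∀ n a b (Y : Ω → ℝ), Measurable[F n] Y → (∀ ω, |Y ω| ≤ 1) →
    ∫ ω, Y ω * (if X n ω = a then 1 else 0) * (if X (n + 1) ω = b then 1 else 0) ∂μ =
      Q a b * ∫ ω, Y ω * (if X n ω = a then 1 else 0) ∂μ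

theorem exists_measure_of_weights {ι : Type*} [Fintype ι] [MeasurableSpace ι]
    [MeasurableSingletonClass ι] {p : ι → ℝ} (hp : ∀ i, 0 ≤ p i) (hp1 : ∑ i, p i = 1) :
    ∃ ν : Measure ι, IsProbabilityMeasure ν ∧ ∀ i, ν.real {i} = p i := by
  have h : ∑ i, ENNReal.ofReal (p i) = 1 := by
    rw [← ENNReal.ofReal_sum_of_nonneg fun i _ => hp i, hp1, ENNReal.ofReal_one]
  refine ⟨(PMF.ofFintype _ h).toMeasure, inferInstance, fun i => ?_⟩
  rw [Measure.real, PMF.toMeasure_apply_singleton _ _ (measurableSet_singleton i),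
    PMF.ofFintype_apply, ENNReal.toReal_ofReal (hp i)]

/-- The path driven by the random maps `ω (n + 1)`, started at the constant map `ω 0`. -/
def randomMapPath {ι : Type*} (i₀ : ι) (ω : ℕ → ι → ι) : ℕ → ι
  | 0 => ω 0 i₀
  | n + 1 => ω (n + 1) (randomMapPath i₀ ω n)

/-- Independent random maps drive the chain: for `n ≥ 1` the value of the `n`-th map at `i` has law
`Q i`, and the map at time `0`, evaluated at `i₀`, has law `q`. The Markov property is then the
independence of the next map from the past. -/
theorem exists_isMarkovChain {ι : Type} [Fintype ι] [DecidableEq ι] [MeasurableSpace ι]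
    [MeasurableSingletonClass ι] {Q : Matrix ι ι ℝ} (hQ : Q ∈ Matrix.rowStochastic ℝ ι)
    {q : ι → ℝ} (hq : ∀ i, 0 ≤ q i) (hq1 : ∑ i, q i = 1) :
    ∃ (Ω : Type) (mΩ : MeasurableSpace Ω) (μ : Measure Ω) (F : Filtration ℕ mΩ)
      (X : ℕ → Ω → ι), IsProbabilityMeasure μ ∧ IsMarkovChain μ F X Q q := by
  have hne : Nonempty ι := by
    by_contra h
    rw [not_nonempty_iff] at h
    simp at hq1
  obtain ⟨i₀⟩ := hne
  obtain ⟨ν, hν, hνq⟩ := exists_measure_of_weights hq hq1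
  choose κ hκ hκQ using fun i => exists_measure_of_weights (p := Q i)
    (fun j => Matrix.nonneg_of_mem_rowStochastic hQ) (Matrix.sum_row_of_mem_rowStochastic hQ i)
  let M : ℕ → Measure (ι → ι) := fun n =>
    if n = 0 then Measure.pi fun _ => ν else Measure.pi κ
  have hM : ∀ n, IsProbabilityMeasure (M n) := by
    intro n
    by_cases hn : n = 0 <;> simp only [M, hn, if_true, if_false] <;> infer_instance
  let μ := Measure.infinitePi M
  let ξ : ℕ → (ℕ → ι → ι) → (ι → ι) := fun n ω => ω n
  have hξ : ∀ n, Measurable (ξ n) := fun n => measurable_pi_apply n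
  let F : Filtration ℕ (inferInstance : MeasurableSpace (ℕ → ι → ι)) :=
    { seq := fun n => ⨆ k ∈ {k | k ≤ n}, MeasurableSpace.comap (ξ k) inferInstance
      mono' := fun a b hab => biSup_mono fun k hk => le_trans hk hab
      le' := fun n => iSup₂_le fun k _ => (hξ k).comap_le }
  have hξF : ∀ n k, k ≤ n → Measurable[F n] (ξ k) := fun n k hk =>
    Measurable.mono (comap_measurable (ξ k))
      (le_iSup₂_of_le (f := fun k (_ : k ∈ {k | k ≤ n}) =>
        MeasurableSpace.comap (ξ k) inferInstance) k hk le_rfl) le_rfl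
  have hindep : iIndepFun ξ μ := iIndepFun_infinitePi (P := M) (X := fun _ f => f)
    fun _ => measurable_id
  have hX : ∀ n, Measurable[F n] fun ω => randomMapPath i₀ ω n := by
    intro n
    induction n with
    | zero => exact (measurable_pi_apply i₀).comp (hξF 0 0 le_rfl)
    | succ n ih =>
      have h1 : Measurable[F (n + 1)] fun ω => (ξ (n + 1) ω, randomMapPath i₀ ω n) :=
        Measurable.prodMk (hξF _ _ le_rfl) (ih.mono (F.mono n.le_succ) le_rfl)
      have h2 : Measurable fun p : (ι → ι) × ι => p.1 p.2 := Measurable.of_discrete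
      exact h2.comp h1
  have hmarg : ∀ n i j, ∫ ω, (if ξ n ω i = j then 1 else 0 : ℝ) ∂μ =
      (M n).real {f | f i = j} := by
    intro n i j
    have hs : MeasurableSet {f : ι → ι | f i = j} :=
      measurableSet_eq_fun (measurable_pi_apply i) measurable_const
    have e : (fun ω => (if ξ n ω i = j then 1 else 0 : ℝ)) =
        (ξ n ⁻¹' {f | f i = j}).indicator 1 := by
      funext ω; simp [Set.indicator_apply]
    rw [e, integral_indicator_one (hξ n hs)]
    exact (measurePreserving_eval_infinitePi M n).measureReal_preimage hs.nullMeasurableSet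
  refine ⟨ℕ → ι → ι, inferInstance, μ, F, fun n ω => randomMapPath i₀ ω n, inferInstance,
    hX, fun a => ?_, fun n a b Y hY hY1 => ?_⟩
  · have := hmarg 0 i₀ a
    simp only [M, if_true] at this
    refine this.trans ?_
    rw [← hνq a]
    exact (measurePreserving_eval (fun _ : ι => ν) i₀).measureReal_preimage
      (measurableSet_singleton a).nullMeasurableSet
  · have hval : ∫ ω, (if ξ (n + 1) ω a = b then 1 else 0 : ℝ) ∂μ = Q a b := by
      rw [hmarg, ← hκQ a b]
      simp only [M, Nat.succ_ne_zero, if_false]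
      exact (measurePreserving_eval κ a).measureReal_preimage
        (measurableSet_singleton b).nullMeasurableSet
    -- On the event `X n = a` the next state is `ξ (n + 1) ω a`, which does not involve the past.
    have e : (fun ω => Y ω * (if randomMapPath i₀ ω n = a then 1 else 0) *
        (if randomMapPath i₀ ω (n + 1) = b then 1 else 0)) =
        (fun ω => Y ω * (if randomMapPath i₀ ω n = a then 1 else 0)) *
          fun ω => (if ξ (n + 1) ω a = b then 1 else 0 : ℝ) := by
      funext ω
      by_cases h : randomMapPath i₀ ω n = a
      · simp [h, randomMapPath, ξ]
      · simp [h]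
    have hA : Measurable[F n] fun ω => Y ω * (if randomMapPath i₀ ω n = a then 1 else 0) :=
      hY.mul (Measurable.ite (hX n (measurableSet_singleton a)) measurable_const measurable_const)
    have hB0 : Measurable fun f : ι → ι => (if f a = b then 1 else 0 : ℝ) :=
      Measurable.ite (measurableSet_eq_fun (measurable_pi_apply a) measurable_const)
        measurable_const measurable_const
    have hind : IndepFun (fun ω => Y ω * (if randomMapPath i₀ ω n = a then 1 else 0))
        (fun ω => (if ξ (n + 1) ω a = b then 1 else 0 : ℝ)) μ := by
      have h1 : Indep (F n) (⨆ k ∈ ({n + 1} : Set ℕ), MeasurableSpace.comap (ξ k) inferInstance) μ :=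
        indep_iSup_of_disjoint (fun k => (hξ k).comap_le) hindep (by simp)
      rw [iSup_singleton] at h1
      refine indep_of_indep_of_le_right (indep_of_indep_of_le_left h1 hA.comap_le) ?_
      exact (hB0.comp (comap_measurable (ξ (n + 1)))).comap_le
    rw [e, hind.integral_mul_eq_mul_integral
      (hA.mono (F.le n) le_rfl).aestronglyMeasurable (hB0.comp (hξ _)).aestronglyMeasurable,
      hval, mul_comm]

/-! ### Laws of large numbers for bounded variables -/

theorem integrable_of_measurable_of_abs_le {Ω : Type*} [MeasurableSpace Ω] {μ : Measure Ω}
    [IsFiniteMeasure μ] {f : Ω → ℝ} (hf : Measurable f) {C : ℝ} (hC : ∀ ω, |f ω| ≤ C) :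
    Integrable f μ :=
  Integrable.of_bound hf.aestronglyMeasurable C
    (ae_of_all _ fun ω => (Real.norm_eq_abs _).trans_le (hC ω))

theorem abs_integral_le_of_abs_le {Ω : Type*} [MeasurableSpace Ω] {μ : Measure Ω}
    [IsProbabilityMeasure μ] {f : Ω → ℝ} {C : ℝ} (hC : ∀ ω, |f ω| ≤ C) :
    |∫ ω, f ω ∂μ| ≤ C := by
  simpa using norm_integral_le_of_norm_le_const (μ := μ) (f := f) (C := C)
    (ae_of_all _ fun ω => (Real.norm_eq_abs _).trans_le (hC ω))

theorem abs_sum_Icc_le {W : ℕ → ℝ} (hW : ∀ k, |W k| ≤ 1) (n : ℕ) :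
    |∑ k ∈ Finset.Icc 1 n, W k| ≤ n := by
  refine (Finset.abs_sum_le_sum_abs _ _).trans ((Finset.sum_le_sum fun k _ => hW k).trans ?_)
  simp

/-- If the averages of a bounded sequence converge to `0` along the squares, they converge
to `0`. -/
theorem tendsto_average_of_tendsto_squares {W : ℕ → ℝ} (hW : ∀ k, |W k| ≤ 1)
    (h : Tendsto (fun n : ℕ => (∑ k ∈ Finset.Icc 1 (n ^ 2), W k) / (n : ℝ) ^ 2) atTop (𝓝 0)) :
    Tendsto (fun n : ℕ => (∑ k ∈ Finset.Icc 1 n, W k) / n) atTop (𝓝 0) := by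
  have hsqrt : Tendsto Nat.sqrt atTop atTop := by
    refine tendsto_atTop.2 fun b => ?_
    filter_upwards [eventually_ge_atTop (b ^ 2)] with n hn
    exact Nat.le_sqrt'.2 hn
  have h1 := ((h.comp hsqrt).abs).add
    ((tendsto_const_div_atTop_nhds_zero_nat (2 : ℝ)).comp hsqrt)
  rw [abs_zero, add_zero] at h1
  refine squeeze_zero_norm' ?_ h1
  filter_upwards [eventually_ge_atTop 1] with n hn
  simp only [Function.comp, Real.norm_eq_abs]
  set k := Nat.sqrt n with hk
  have hk1 : 1 ≤ k := Nat.le_sqrt'.2 (by simpa using hn)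
  have hkn : k ^ 2 ≤ n := Nat.sqrt_le' n
  have hnk : n < (k + 1) ^ 2 := Nat.lt_succ_sqrt' n
  have hsplit : ∑ j ∈ Finset.Icc 1 n, W j =
      ∑ j ∈ Finset.Icc 1 (k ^ 2), W j + ∑ j ∈ Finset.Ioc (k ^ 2) n, W j := by
    rw [← Finset.sum_union]
    · congr 1
      ext j
      simp only [Finset.mem_Icc, Finset.mem_union, Finset.mem_Ioc]
      lia
    · rw [Finset.disjoint_left]
      intro j
      simp only [Finset.mem_Icc, Finset.mem_Ioc]
      lia
  -- Fewer than `2 * k + 1` terms lie beyond the last square, so they contribute `O(1 / k)` to the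
  -- average.
  have htail : |∑ j ∈ Finset.Ioc (k ^ 2) n, W j| ≤ 2 * k := by
    refine (Finset.abs_sum_le_sum_abs _ _).trans ((Finset.sum_le_sum fun j _ => hW j).trans ?_)
    simp only [Finset.sum_const, Nat.card_Ioc, nsmul_eq_mul, mul_one]
    have : n - k ^ 2 ≤ 2 * k := by
      have : (k + 1) ^ 2 = k ^ 2 + 2 * k + 1 := by ring
      lia
    exact_mod_cast this
  have hk0 : (0 : ℝ) < k := by exact_mod_cast hk1
  have hkn' : (k : ℝ) ^ 2 ≤ n := by exact_mod_cast hkn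
  have hn0 : (0 : ℝ) < n := by exact_mod_cast hn
  rw [hsplit, abs_div, abs_div, abs_of_pos hn0, abs_of_pos (pow_pos hk0 2)]
  calc |∑ j ∈ Finset.Icc 1 (k ^ 2), W j + ∑ j ∈ Finset.Ioc (k ^ 2) n, W j| / n
      ≤ (|∑ j ∈ Finset.Icc 1 (k ^ 2), W j| + 2 * k) / (k : ℝ) ^ 2 := by
        have := abs_add_le (∑ j ∈ Finset.Icc 1 (k ^ 2), W j) (∑ j ∈ Finset.Ioc (k ^ 2) n, W j)
        exact div_le_div₀ (by positivity) (by linarith) (by positivity) hkn'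
    _ = _ := by
        rw [add_div]
        congr 1
        field_simp

/-- A law of large numbers for bounded variables whose partial sums have second moments of linear
growth. -/
theorem ae_tendsto_average_of_second_moment {Ω : Type*} [MeasurableSpace Ω] {μ : Measure Ω}
    [IsProbabilityMeasure μ] {W : ℕ → Ω → ℝ} (hWm : ∀ k, Measurable (W k))
    (hW : ∀ k ω, |W k ω| ≤ 1) {K : ℝ}
    (hK : ∀ n : ℕ, ∫ ω, (∑ k ∈ Finset.Icc 1 n, W k ω) ^ 2 ∂μ ≤ K * n) :
    ∀ᵐ ω ∂μ, Tendsto (fun n : ℕ => (∑ k ∈ Finset.Icc 1 n, W k ω) / n) atTop (𝓝 0) := by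
  -- The squared averages along the squares have means at most `K / n ^ 2`. These are summable, so
  -- almost surely the squares themselves are summable and tend to `0`.
  let f : ℕ → Ω → ℝ := fun n ω => ((∑ k ∈ Finset.Icc 1 (n ^ 2), W k ω) / (n : ℝ) ^ 2) ^ 2
  have hf0 : ∀ n ω, 0 ≤ f n ω := fun n ω => sq_nonneg _
  have hfm : ∀ n, Measurable (f n) := fun n =>
    ((Finset.measurable_sum _ fun k _ => hWm k).div_const _).pow_const 2
  have hint : ∀ n, ∫⁻ ω, ENNReal.ofReal (f n ω) ∂μ ≤ ENNReal.ofReal (K * (1 / (n : ℝ) ^ 2)) := by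
    intro n
    have hfi : Integrable (f n) μ := by
      refine integrable_of_measurable_of_abs_le (C := 1) (hfm n) fun ω => ?_
      rw [abs_of_nonneg (hf0 n ω)]
      have := abs_sum_Icc_le (fun k => hW k ω) (n ^ 2)
      push_cast at this
      rw [sq_le_one_iff_abs_le_one, abs_div, abs_of_nonneg (by positivity : (0 : ℝ) ≤ (n : ℝ) ^ 2)]
      exact div_le_one_of_le₀ this (by positivity)
    rw [← ofReal_integral_eq_lintegral_ofReal hfi (ae_of_all _ (hf0 n))]
    refine ENNReal.ofReal_le_ofReal ?_
    have e : ∀ ω, f n ω = (1 / (n : ℝ) ^ 2) ^ 2 * (∑ k ∈ Finset.Icc 1 (n ^ 2), W k ω) ^ 2 := by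
      intro ω
      simp only [f]
      ring
    simp_rw [e]
    rw [integral_const_mul]
    have := hK (n ^ 2)
    push_cast at this
    rcases Nat.eq_zero_or_pos n with rfl | hn
    · simp
    · have hn' : (0 : ℝ) < n := by exact_mod_cast hn
      calc _ ≤ (1 / (n : ℝ) ^ 2) ^ 2 * (K * (n : ℝ) ^ 2) := by gcongr
        _ = _ := by field_simp
  have hsum : ∑' n, ∫⁻ ω, ENNReal.ofReal (f n ω) ∂μ ≠ ⊤ := by
    refine ne_top_of_le_ne_top ?_ (ENNReal.tsum_le_tsum hint)
    exact ((Real.summable_one_div_nat_pow.2 (by norm_num)).mul_left K).tsum_ofReal_ne_top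
  rw [← lintegral_tsum fun n => (hfm n).ennreal_ofReal.aemeasurable] at hsum
  filter_upwards [ae_lt_top (Measurable.tsum fun n => (hfm n).ennreal_ofReal) hsum]
    with ω hω
  refine tendsto_average_of_tendsto_squares (fun k => hW k ω) ?_
  have h0 := ENNReal.tendsto_atTop_zero_of_tsum_ne_top hω.ne
  have h1 := (ENNReal.tendsto_toReal ENNReal.zero_ne_top).comp h0
  have h2 : Tendsto (fun n => f n ω) atTop (𝓝 0) := by
    simpa [Function.comp_def, ENNReal.toReal_ofReal (hf0 _ ω)] using h1
  have h3 := h2.sqrt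
  rw [Real.sqrt_zero] at h3
  simp only [f, Real.sqrt_sq_eq_abs] at h3
  exact (tendsto_zero_iff_abs_tendsto_zero _).2 h3

/-- A law of large numbers for bounded variables with summable correlations. -/
theorem ae_tendsto_average_of_correlation {Ω : Type*} [MeasurableSpace Ω] {μ : Measure Ω}
    [IsProbabilityMeasure μ] {W : ℕ → Ω → ℝ} (hWm : ∀ k, Measurable (W k))
    (hW : ∀ k ω, |W k ω| ≤ 1) {K : ℝ}
    (hK : ∀ n : ℕ, ∑ j ∈ Finset.Icc 1 n, |∫ ω, W j ω * W (n + 1) ω ∂μ| ≤ K) :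
    ∀ᵐ ω ∂μ, Tendsto (fun n : ℕ => (∑ k ∈ Finset.Icc 1 n, W k ω) / n) atTop (𝓝 0) := by
  -- Passing from `n` to `n + 1` adds to the second moment at most twice the correlations, `2 * K`,
  -- plus a square of mean at most `1`.
  refine ae_tendsto_average_of_second_moment hWm hW (K := 2 * K + 1) fun n => ?_
  have hSm : ∀ n, Measurable fun ω => ∑ k ∈ Finset.Icc 1 n, W k ω := fun n =>
    Finset.measurable_sum _ fun k _ => hWm k
  have hS : ∀ n ω, |∑ k ∈ Finset.Icc 1 n, W k ω| ≤ n := fun n ω =>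
    abs_sum_Icc_le (fun k => hW k ω) n
  induction n with
  | zero => simp
  | succ n ih =>
    have e : ∀ ω, (∑ k ∈ Finset.Icc 1 (n + 1), W k ω) ^ 2 =
        (∑ k ∈ Finset.Icc 1 n, W k ω) ^ 2 +
          (2 * ∑ j ∈ Finset.Icc 1 n, W j ω * W (n + 1) ω + W (n + 1) ω ^ 2) := by
      intro ω
      rw [Finset.sum_Icc_succ_top (by lia), ← Finset.sum_mul]
      ring
    have i1 : Integrable (fun ω => (∑ k ∈ Finset.Icc 1 n, W k ω) ^ 2) μ := by
      refine integrable_of_measurable_of_abs_le (C := (n : ℝ) ^ 2) ((hSm n).pow_const 2) fun ω => ?_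
      rw [abs_pow]
      exact pow_le_pow_left₀ (abs_nonneg _) (hS n ω) 2
    have i3 : ∀ j, Integrable (fun ω => W j ω * W (n + 1) ω) μ := fun j => by
      refine integrable_of_measurable_of_abs_le (C := 1) ((hWm j).mul (hWm _)) fun ω => ?_
      rw [abs_mul]
      exact mul_le_one₀ (hW j ω) (abs_nonneg _) (hW _ ω)
    have i2 : Integrable (fun ω => 2 * ∑ j ∈ Finset.Icc 1 n, W j ω * W (n + 1) ω) μ :=
      (integrable_finsetSum _ fun j _ => i3 j).const_mul 2
    have i4 : Integrable (fun ω => W (n + 1) ω ^ 2) μ := by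
      simpa only [sq] using i3 (n + 1)
    simp_rw [e]
    have i5 : Integrable (fun ω => 2 * ∑ j ∈ Finset.Icc 1 n, W j ω * W (n + 1) ω +
        W (n + 1) ω ^ 2) μ := i2.add i4
    rw [integral_add i1 i5, integral_add i2 i4, integral_const_mul,
      integral_finsetSum _ fun j _ => i3 j]
    have h1 : ∑ j ∈ Finset.Icc 1 n, ∫ ω, W j ω * W (n + 1) ω ∂μ ≤ K :=
      (Finset.sum_le_sum fun j _ => le_abs_self _).trans (hK n)
    have h2 : ∫ ω, W (n + 1) ω ^ 2 ∂μ ≤ 1 := by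
      refine (le_abs_self _).trans (abs_integral_le_of_abs_le fun ω => ?_)
      rw [abs_pow]
      exact pow_le_one₀ (abs_nonneg _) (hW _ ω)
    push_cast
    linarith

/-! ### Mixing and the nonconventional law of large numbers -/

namespace IsMarkovChain

variable {ι Ω : Type*} [DecidableEq ι] [MeasurableSpace ι] [MeasurableSingletonClass ι]
  {mΩ : MeasurableSpace Ω} {μ : Measure Ω} {F : Filtration ℕ mΩ} {X : ℕ → Ω → ι}
  {Q : Matrix ι ι ℝ} {q : ι → ℝ}

theorem measurable_ite (h : IsMarkovChain μ F X Q q) {n k : ℕ} (hk : k ≤ n) (a : ι) :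
    Measurable[F n] fun ω => (if X k ω = a then 1 else 0 : ℝ) :=
  Measurable.ite (((h.adapted k).mono (F.mono hk) le_rfl) (measurableSet_singleton a))
    measurable_const measurable_const

variable [Fintype ι]

/-- Chapman–Kolmogorov, tested against bounded variables of the past in place of conditional
expectations. -/
theorem integral_mul_ite_add [IsProbabilityMeasure μ] (h : IsMarkovChain μ F X Q q) {s : ℕ}
    {Y : Ω → ℝ} (hY : Measurable[F s] Y) (hY1 : ∀ ω, |Y ω| ≤ 1) (d : ℕ) (a : ι) :
    ∫ ω, Y ω * (if X (s + d) ω = a then 1 else 0) ∂μ =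
      ∑ i, (∫ ω, Y ω * (if X s ω = i then 1 else 0) ∂μ) * (Q ^ d) i a := by
  induction d generalizing a with
  | zero => simp [Matrix.one_apply]
  | succ d ih =>
    have e : ∀ ω, Y ω * (if X (s + (d + 1)) ω = a then 1 else 0) =
        ∑ b, Y ω * (if X (s + d) ω = b then 1 else 0) *
          (if X (s + d + 1) ω = a then 1 else 0) := by
      intro ω
      rw [← Finset.sum_mul, ← Finset.mul_sum]
      simp [add_assoc]
    have hYm : Measurable[F (s + d)] Y := hY.mono (F.mono (Nat.le_add_right s d)) le_rfl
    simp_rw [e]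
    rw [integral_finsetSum]
    · simp_rw [h.transition (s + d) _ a Y hYm hY1, ih, pow_succ, Matrix.mul_apply,
        Finset.mul_sum]
      rw [Finset.sum_comm]
      exact Finset.sum_congr rfl fun i _ => Finset.sum_congr rfl fun j _ => by ring
    · intro b _
      refine integrable_of_measurable_of_abs_le (C := 1) ?_ fun ω => ?_
      · exact ((hYm.mono (F.le _) le_rfl).mul
          ((h.measurable_ite le_rfl b).mono (F.le _) le_rfl)).mul
          ((h.measurable_ite le_rfl a).mono (F.le _) le_rfl)
      · have := hY1 ω
        split_ifs <;> simp [this]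

/-- The step from `t` to `t + 1` factors out as `Q a b`. What remains compares row `i` of `Q ^ (t -
s)` with `q`, where `i` is the state at time `s`; summing over `i` costs the factor `Fintype.card
ι`. -/
theorem abs_integral_mul_sub_le [IsProbabilityMeasure μ] (h : IsMarkovChain μ F X Q q)
    (hQ : Q ∈ Matrix.rowStochastic ℝ ι)
    {C ρ : ℝ} (hmix : ∀ d i j, |(Q ^ d) i j - q j| ≤ C * ρ ^ d) {s t : ℕ} (hst : s ≤ t)
    {Y : Ω → ℝ} (hY : Measurable[F s] Y) (hY1 : ∀ ω, |Y ω| ≤ 1) (a b : ι) :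
    |∫ ω, Y ω * ((if X t ω = a then 1 else 0) * (if X (t + 1) ω = b then 1 else 0) -
      q a * Q a b) ∂μ| ≤ Fintype.card ι * C * ρ ^ (t - s) := by
  obtain ⟨d, rfl⟩ := Nat.exists_eq_add_of_le hst
  rw [Nat.add_sub_cancel_left]
  have hYm : Measurable[F (s + d)] Y := hY.mono (F.mono hst) le_rfl
  have hYm' : Measurable Y := hYm.mono (F.le _) le_rfl
  have hm : ∀ k c, Measurable fun ω => (if X k ω = c then 1 else 0 : ℝ) := fun k c =>
    (h.measurable_ite le_rfl c).mono (F.le k) le_rfl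
  have i0 : Integrable Y μ := integrable_of_measurable_of_abs_le hYm' hY1
  have i1 : ∀ k c, Integrable (fun ω => Y ω * (if X k ω = c then 1 else 0)) μ := fun k c =>
    integrable_of_measurable_of_abs_le (C := 1) (hYm'.mul (hm k c)) fun ω => by
      have := hY1 ω
      split_ifs <;> simp [this]
  have i2 : Integrable (fun ω => Y ω * (if X (s + d) ω = a then 1 else 0) *
      (if X (s + d + 1) ω = b then 1 else 0)) μ :=
    integrable_of_measurable_of_abs_le (C := 1) ((hYm'.mul (hm _ _)).mul (hm _ _)) fun ω => by
      have := hY1 ω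
      split_ifs <;> simp [this]
  have hYsum : ∫ ω, Y ω ∂μ = ∑ i, ∫ ω, Y ω * (if X s ω = i then 1 else 0) ∂μ := by
    rw [← integral_finsetSum _ fun i _ => i1 s i]
    simp
  have e : ∫ ω, Y ω * ((if X (s + d) ω = a then 1 else 0) *
      (if X (s + d + 1) ω = b then 1 else 0) - q a * Q a b) ∂μ =
      Q a b * ∑ i, (∫ ω, Y ω * (if X s ω = i then 1 else 0) ∂μ) * ((Q ^ d) i a - q a) := by
    have e1 : ∀ ω, Y ω * ((if X (s + d) ω = a then 1 else 0) *
        (if X (s + d + 1) ω = b then 1 else 0) - q a * Q a b) =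
        Y ω * (if X (s + d) ω = a then 1 else 0) * (if X (s + d + 1) ω = b then 1 else 0) -
          Y ω * (q a * Q a b) := fun ω => by ring
    simp_rw [e1]
    rw [integral_sub i2 (i0.mul_const _), h.transition _ a b Y hYm hY1, integral_mul_const,
      h.integral_mul_ite_add hY hY1, hYsum]
    simp only [mul_sub, Finset.sum_sub_distrib, ← Finset.sum_mul]
    ring
  rw [e, abs_mul, abs_of_nonneg (Matrix.nonneg_of_mem_rowStochastic hQ)]
  have h1 : |∑ i, (∫ ω, Y ω * (if X s ω = i then 1 else 0) ∂μ) * ((Q ^ d) i a - q a)| ≤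
      Fintype.card ι * C * ρ ^ d := by
    refine (Finset.abs_sum_le_sum_abs _ _).trans ?_
    refine (Finset.sum_le_sum (g := fun _ => C * ρ ^ d) fun i _ => ?_).trans ?_
    · rw [abs_mul]
      refine (mul_le_of_le_one_left (abs_nonneg _) ?_).trans (hmix d i a)
      refine abs_integral_le_of_abs_le fun ω => ?_
      have := hY1 ω
      split_ifs <;> simp [this]
    · simp [mul_assoc]
  exact (mul_le_of_le_one_left (abs_nonneg _) (Matrix.le_one_of_mem_rowStochastic hQ)).trans h1

/-- The transitions at the times `t k` are asymptotically uncorrelated with bounded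
variables `G k` which are determined a time of order `k` earlier. -/
theorem ae_tendsto_average_mul_sub [IsProbabilityMeasure μ] (h : IsMarkovChain μ F X Q q)
    (hQ : Q ∈ Matrix.rowStochastic ℝ ι) (hq : ∀ i, 0 ≤ q i) (hq1 : ∑ i, q i = 1)
    {C ρ : ℝ} (hC : 0 < C) (hρ0 : 0 < ρ) (hρ1 : ρ < 1)
    (hmix : ∀ d i j, |(Q ^ d) i j - q j| ≤ C * ρ ^ d) {σ t : ℕ → ℕ} {ε : ℝ} (hε : 0 < ε)
    (ht : ∀ n, 1 ≤ n → t n < t (n + 1)) (hσ : ∀ n, 1 ≤ n → σ n ≤ t n)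
    (hσε : ∀ n : ℕ, 1 ≤ n → ε * n ≤ (t n : ℝ) - σ n + 1)
    {G : ℕ → Ω → ℝ} (hG : ∀ n, Measurable[F (σ n)] (G n)) (hG1 : ∀ n ω, |G n ω| ≤ 1) (a b : ι) :
    ∀ᵐ ω ∂μ, Tendsto (fun n : ℕ => (∑ k ∈ Finset.Icc 1 n, G k ω *
      ((if X (t k) ω = a then 1 else 0) * (if X (t k + 1) ω = b then 1 else 0) -
        q a * Q a b)) / n) atTop (𝓝 0) := by
  have hr0 : 0 ≤ q a * Q a b := mul_nonneg (hq a) (Matrix.nonneg_of_mem_rowStochastic hQ)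
  have hr1 : q a * Q a b ≤ 1 := mul_le_one₀
    (hq1 ▸ Finset.single_le_sum (fun j _ => hq j) (Finset.mem_univ a))
    (Matrix.nonneg_of_mem_rowStochastic hQ) (Matrix.le_one_of_mem_rowStochastic hQ)
  let g : ℕ → Ω → ℝ := fun k ω =>
    (if X (t k) ω = a then 1 else 0) * (if X (t k + 1) ω = b then 1 else 0) - q a * Q a b
  have hg1 : ∀ k ω, |g k ω| ≤ 1 := by
    intro k ω
    simp only [g]
    split_ifs <;> simp only [mul_one, mul_zero] <;> rw [abs_le] <;> constructor <;> linarith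
  have hgm : ∀ k, Measurable[F (t k + 1)] (g k) := fun k =>
    ((h.measurable_ite (Nat.le_succ _) a).mul (h.measurable_ite le_rfl b)).sub measurable_const
  have hW1 : ∀ k ω, |G k ω * g k ω| ≤ 1 := fun k ω => by
    rw [abs_mul]
    exact mul_le_one₀ (hG1 k ω) (abs_nonneg _) (hg1 k ω)
  have htlt : ∀ j k, 1 ≤ j → t j + k ≤ t (j + k) := by
    intro j k hj
    induction k with
    | zero => simp
    | succ k ih =>
      have := ht (j + k) (by lia)
      rw [← add_assoc j]
      lia
  set D : ℝ := Fintype.card ι * C with hD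
  have hD0 : 0 ≤ D := by positivity
  -- By the linear gap, `ρ ^ (t n - σ n)` is at most `ρ⁻¹ * η ^ n`.
  set η : ℝ := ρ ^ ε with hη
  have hη0 : 0 < η := Real.rpow_pos_of_pos hρ0 _
  have hη1 : η < 1 := Real.rpow_lt_one hρ0.le hρ1 hε
  -- The gap term does not depend on `j`, so it is summed `n` times and `n * η ^ (n + 1)` must stay
  -- bounded.
  obtain ⟨B, hB⟩ : ∃ B, ∀ n : ℕ, (n : ℝ) * η ^ n ≤ B := by
    obtain ⟨B, hB⟩ := (tendsto_self_mul_const_pow_of_lt_one hη0.le hη1).bddAbove_range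
    exact ⟨B, fun n => hB ⟨n, rfl⟩⟩
  have hcorr : ∀ j k, 1 ≤ j → j < k → |∫ ω, (G j ω * g j ω) * (G k ω * g k ω) ∂μ| ≤
      D * (ρ ^ (k - j - 1) + ρ⁻¹ * η ^ k) := by
    intro j k hj hjk
    obtain ⟨d, rfl⟩ : ∃ d, k = j + d := ⟨k - j, by lia⟩
    have h1 := htlt j d hj
    have h2 := hσ (j + d) (by lia)
    -- All factors except `g (j + d)` are known at this maximum. The time left until `t (j + d)` is
    -- controlled by the growth of `t` or by the linear gap, whichever is shorter; the bound adds
    -- both cases.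
    have hG' : Measurable[F (max (t j + 1) (σ (j + d)))] fun ω =>
        (G j ω * g j ω) * G (j + d) ω := by
      have hσj : σ j ≤ max (t j + 1) (σ (j + d)) :=
        ((hσ j hj).trans (Nat.le_succ _)).trans (le_max_left _ _)
      exact ((((hG j).mono (F.mono hσj) le_rfl)).mul
        ((hgm j).mono (F.mono (le_max_left _ _)) le_rfl)).mul
        ((hG _).mono (F.mono (le_max_right _ _)) le_rfl)
    have h3 := h.abs_integral_mul_sub_le hQ hmix (s := max (t j + 1) (σ (j + d)))
      (t := t (j + d)) (max_le (by lia) h2) hG' (fun ω => by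
        rw [abs_mul]
        exact mul_le_one₀ (hW1 j ω) (abs_nonneg _) (hG1 _ ω)) a b
    have e : ∀ ω, (G j ω * g j ω) * G (j + d) ω * g (j + d) ω =
        (G j ω * g j ω) * (G (j + d) ω * g (j + d) ω) := fun ω => by ring
    change |∫ ω, (G j ω * g j ω) * G (j + d) ω * g (j + d) ω ∂μ| ≤ _ at h3
    simp_rw [e] at h3
    refine h3.trans (mul_le_mul_of_nonneg_left ?_ hD0)
    have hp1 : 0 ≤ ρ ^ (j + d - j - 1) := by positivity
    have hp2 : 0 ≤ ρ⁻¹ * η ^ (j + d) := by positivity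
    rcases le_total (t j + 1) (σ (j + d)) with hle | hle
    · rw [max_eq_right hle]
      have : ρ ^ (t (j + d) - σ (j + d)) ≤ ρ⁻¹ * η ^ (j + d) := by
        have h4 := hσε (j + d) (by lia)
        rw [← Nat.cast_sub h2] at h4
        rw [← Real.rpow_natCast ρ, ← Real.rpow_natCast η, hη, ← Real.rpow_mul hρ0.le,
          ← Real.rpow_neg_one ρ, ← Real.rpow_add hρ0]
        exact Real.rpow_le_rpow_of_exponent_ge hρ0 hρ1.le (by linarith)
      linarith
    · rw [max_eq_left hle]
      have : ρ ^ (t (j + d) - (t j + 1)) ≤ ρ ^ (j + d - j - 1) :=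
        pow_le_pow_of_le_one hρ0.le hρ1.le (by lia)
      linarith
  refine ae_tendsto_average_of_correlation (W := fun k ω => G k ω * g k ω)
    (fun k => ((hG k).mono (F.le _) le_rfl).mul ((hgm k).mono (F.le _) le_rfl)) hW1
    (K := D * ((1 - ρ)⁻¹ + ρ⁻¹ * B)) fun n => ?_
  calc ∑ j ∈ Finset.Icc 1 n, |∫ ω, (G j ω * g j ω) * (G (n + 1) ω * g (n + 1) ω) ∂μ|
      ≤ ∑ j ∈ Finset.Icc 1 n, D * (ρ ^ (n + 1 - j - 1) + ρ⁻¹ * η ^ (n + 1)) :=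
        Finset.sum_le_sum fun j hj => by
          rw [Finset.mem_Icc] at hj
          exact hcorr j (n + 1) hj.1 (by lia)
    _ = D * (∑ j ∈ Finset.range n, ρ ^ j + n * (ρ⁻¹ * η ^ (n + 1))) := by
        rw [← Finset.mul_sum, Finset.sum_add_distrib]
        congr 2
        · refine Finset.sum_nbij' (fun j => n - j) (fun j => n - j) ?_ ?_ ?_ ?_ ?_ <;>
            intro j hj <;> simp only [Finset.mem_Icc, Finset.mem_range] at hj ⊢ <;> try lia
        · simp
    _ ≤ D * ((1 - ρ)⁻¹ + ρ⁻¹ * B) := by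
        refine mul_le_mul_of_nonneg_left (add_le_add ?_ ?_) hD0
        · rw [← tsum_geometric_of_lt_one hρ0.le hρ1]
          exact (summable_geometric_of_lt_one hρ0.le hρ1).sum_le_tsum _ fun j _ => by positivity
        · have h5 := hB (n + 1)
          push_cast at h5
          have h6 : (n : ℝ) * η ^ (n + 1) ≤ B := by
            have : 0 < η ^ (n + 1) := by positivity
            linarith
          calc (n : ℝ) * (ρ⁻¹ * η ^ (n + 1)) = ρ⁻¹ * (n * η ^ (n + 1)) := by ring
            _ ≤ ρ⁻¹ * B := mul_le_mul_of_nonneg_left h6 (by positivity)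

/-- The nonconventional law of large numbers: the transitions at the times `τ i k` become
independent on average. -/
theorem ae_tendsto_average_prod [IsProbabilityMeasure μ] (h : IsMarkovChain μ F X Q q)
    (hQ : Q ∈ Matrix.rowStochastic ℝ ι) (hq : ∀ i, 0 ≤ q i) (hq1 : ∑ i, q i = 1)
    {C ρ : ℝ} (hC : 0 < C) (hρ0 : 0 < ρ) (hρ1 : ρ < 1)
    (hmix : ∀ d i j, |(Q ^ d) i j - q j| ≤ C * ρ ^ d) {ε : ℝ} (hε : 0 < ε) (hε1 : ε ≤ 1)
    {ℓ : ℕ} (τ : Fin ℓ → ℕ → ℕ) (hτ : ∀ i n, 1 ≤ n → τ i n < τ i (n + 1))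
    (hgap : ∀ i j, i < j → ∀ n : ℕ, 1 ≤ n → (τ i n : ℝ) + ε * n ≤ τ j n) (α β : Fin ℓ → ι) :
    ∀ᵐ ω ∂μ, Tendsto (fun n : ℕ => (∑ k ∈ Finset.Icc 1 n, ∏ i,
      ((if X (τ i k) ω = α i then 1 else 0) * (if X (τ i k + 1) ω = β i then 1 else 0) : ℝ)) / n)
      atTop (𝓝 (∏ i, q (α i) * Q (α i) (β i))) := by
  induction ℓ with
  | zero =>
    refine ae_of_all _ fun ω => tendsto_const_nhds.congr' ?_
    filter_upwards [eventually_ge_atTop 1] with n hn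
    have : (n : ℝ) ≠ 0 := by positivity
    simp [this]
  | succ ℓ ih =>
    let f : Fin (ℓ + 1) → ℕ → Ω → ℝ := fun i k ω =>
      (if X (τ i k) ω = α i then 1 else 0) * (if X (τ i k + 1) ω = β i then 1 else 0)
    -- By time `σ k` all earlier transitions have been observed, endpoints included. With no earlier
    -- factor the supremum is `0`, and the gap comes from the growth of `τ (Fin.last ℓ)` and `ε ≤
    -- 1`.
    let σ : ℕ → ℕ := fun k => Finset.univ.sup fun i : Fin ℓ => τ i.castSucc k + 1
    have hσ : ∀ i k, τ (Fin.castSucc i) k + 1 ≤ σ k := fun i k =>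
      Finset.le_sup (f := fun i : Fin ℓ => τ i.castSucc k + 1) (Finset.mem_univ i)
    have hlast : ∀ k, k ≤ τ (Fin.last ℓ) (k + 1) := by
      intro k
      induction k with
      | zero => simp
      | succ k ihk =>
        have := hτ (Fin.last ℓ) (k + 1) (by lia)
        lia
    have hσε : ∀ n : ℕ, 1 ≤ n →
        σ n ≤ τ (Fin.last ℓ) n ∧ ε * n ≤ (τ (Fin.last ℓ) n : ℝ) - σ n + 1 := by
      intro n hn
      have hn' : (0 : ℝ) < n := by exact_mod_cast hn
      rcases Nat.eq_zero_or_pos ℓ with rfl | hℓ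
      · have h0 : σ n = 0 := by simp [σ]
        obtain ⟨k, rfl⟩ : ∃ k, n = k + 1 := ⟨n - 1, by lia⟩
        have h1 : (k : ℝ) ≤ τ (Fin.last 0) (k + 1) := by exact_mod_cast hlast k
        rw [h0]
        refine ⟨Nat.zero_le _, ?_⟩
        rw [Nat.cast_zero, Nat.cast_succ]
        rw [Nat.cast_succ] at hn'
        nlinarith
      · obtain ⟨i, -, hi⟩ := Finset.exists_mem_eq_sup (Finset.univ : Finset (Fin ℓ))
          ⟨⟨0, hℓ⟩, Finset.mem_univ _⟩ fun i : Fin ℓ => τ i.castSucc n + 1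
        have h0 : σ n = τ i.castSucc n + 1 := hi
        have h1 := hgap i.castSucc (Fin.last ℓ) (Fin.castSucc_lt_last i) n hn
        have h2 : (τ i.castSucc n : ℝ) < τ (Fin.last ℓ) n := by nlinarith
        rw [h0]
        refine ⟨by exact_mod_cast h2, ?_⟩
        push_cast
        linarith
    have hfm : ∀ i k n, τ i k + 1 ≤ n → Measurable[F n] (f i k) := fun i k n hn =>
      (h.measurable_ite (by lia) _).mul (h.measurable_ite hn _)
    have hG : ∀ k, Measurable[F (σ k)] fun ω => ∏ i : Fin ℓ, f i.castSucc k ω := fun k =>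
      Finset.measurable_prod _ fun i _ => hfm _ _ _ (hσ i k)
    have hG1 : ∀ k ω, |∏ i : Fin ℓ, f i.castSucc k ω| ≤ 1 := by
      intro k ω
      rw [Finset.abs_prod]
      refine Finset.prod_le_one (fun _ _ => abs_nonneg _) fun i _ => ?_
      simp only [f]
      split_ifs <;> simp
    filter_upwards [h.ae_tendsto_average_mul_sub hQ hq hq1 hC hρ0 hρ1 hmix hε
      (hτ (Fin.last ℓ)) (fun n hn => (hσε n hn).1) (fun n hn => (hσε n hn).2) hG hG1
      (α (Fin.last ℓ)) (β (Fin.last ℓ)), ih (fun i => τ i.castSucc) (fun i => hτ _)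
      (fun i j hij => hgap _ _ (Fin.castSucc_lt_castSucc_iff.2 hij)) (fun i => α i.castSucc)
      (fun i => β i.castSucc)] with ω h1 h2
    rw [Fin.prod_univ_castSucc]
    -- The last factor is split into its centred part, which averages to `0` against the others, and
    -- its mean, to which the induction hypothesis applies.
    have h3 := h1.add (h2.mul_const (q (α (Fin.last ℓ)) * Q (α (Fin.last ℓ)) (β (Fin.last ℓ))))
    rw [zero_add] at h3
    refine h3.congr fun n => ?_
    rw [div_mul_eq_mul_div, ← add_div, Finset.sum_mul, ← Finset.sum_add_distrib]
    congr 1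
    refine Finset.sum_congr rfl fun k _ => ?_
    rw [Fin.prod_univ_castSucc]
    simp only [f]
    ring

end IsMarkovChain

/-! ### Base-`m` expansions -/

theorem Real.digits_eq_of_floor_eq {m : ℕ} [NeZero m] {x y : ℝ} {n : ℕ}
    (h : ⌊x * (m : ℝ) ^ n⌋₊ = ⌊y * (m : ℝ) ^ n⌋₊) {i : ℕ} (hi : i < n) :
    Real.digits x m i = Real.digits y m i := by
  have key : ∀ z : ℝ, ⌊z * (m : ℝ) ^ (i + 1)⌋₊ = ⌊z * (m : ℝ) ^ n⌋₊ / m ^ (n - (i + 1)) := by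
    intro z
    rw [← Nat.floor_div_natCast]
    congr 1
    have hm : (m : ℝ) ≠ 0 := Nat.cast_ne_zero.2 (NeZero.ne m)
    push_cast
    rw [eq_div_iff (pow_ne_zero _ hm), mul_assoc, ← pow_add]
    congr 2
    lia
  simp only [Real.digits, key, h]

theorem Real.ofDigits_eq_head_add {m : ℕ} (a : ℕ → Fin m) :
    Real.ofDigits a = (m : ℝ)⁻¹ * ((a 0 : ℕ) + Real.ofDigits fun i => a (i + 1)) := by
  rw [Real.ofDigits_eq_sum_add_ofDigits a 1]
  simp [Real.ofDigitsTerm]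
  ring

theorem Real.ofDigits_lt_one {m : ℕ} (hm : 1 < m) {a : ℕ → Fin m} {i : ℕ}
    (hi : (a i : ℕ) ≠ m - 1) : Real.ofDigits a < 1 := by
  rw [← Real.ofDigits_const_last_eq_one' hm]
  refine Summable.tsum_lt_tsum (i := i) (fun n => ?_) ?_ Real.summable_ofDigitsTerm
    Real.summable_ofDigitsTerm
  · simp only [Real.ofDigitsTerm]
    have : (a n : ℕ) ≤ m - 1 := by have := (a n).2; lia
    gcongr
  · simp only [Real.ofDigitsTerm]
    have : (a i : ℕ) < m - 1 := by have := (a i).2; lia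
    gcongr

theorem Real.ofDigits_pos {m : ℕ} (hm : 1 < m) {a : ℕ → Fin m} {i : ℕ}
    (hi : (a i : ℕ) ≠ 0) : 0 < Real.ofDigits a := by
  refine Real.summable_ofDigitsTerm.tsum_pos (fun _ => Real.ofDigitsTerm_nonneg) i ?_
  have : 0 < (a i : ℕ) := Nat.pos_of_ne_zero hi
  simp only [Real.ofDigitsTerm]
  positivity

/-- A sequence of digits without a tail of digits `m - 1` is the digit sequence of its value. -/
theorem Real.digits_ofDigits {m : ℕ} [NeZero m] (hm : 1 < m) {a : ℕ → Fin m}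
    (ha : ∀ n, ∃ i, n ≤ i ∧ (a i : ℕ) ≠ m - 1) : Real.digits (Real.ofDigits a) m = a := by
  have hm0 : (m : ℝ) ≠ 0 := Nat.cast_ne_zero.2 (NeZero.ne m)
  -- Multiplying by `m ^ n` shifts the digits up to an integer. The remaining tail is less than `1`
  -- by `ha`, so floors read the digits off exactly.
  have key : ∀ n, ∃ K : ℕ, Real.ofDigits a * (m : ℝ) ^ n = K + Real.ofDigits fun i => a (i + n) := by
    intro n
    induction n with
    | zero => exact ⟨0, by simp⟩
    | succ n ih =>
      obtain ⟨K, hK⟩ := ih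
      refine ⟨K * m + a n, ?_⟩
      rw [pow_succ, ← mul_assoc, hK, Real.ofDigits_eq_head_add fun i => a (i + n)]
      have e : (fun i => a (i + 1 + n)) = fun i => a (i + (n + 1)) := by
        funext i
        congr 1
        ring
      rw [e]
      push_cast
      field_simp
      simp
      ring
  funext n
  obtain ⟨K, hK⟩ := key n
  have hlt : Real.ofDigits (fun i => a (i + (n + 1))) < 1 := by
    obtain ⟨i, hi, hi'⟩ := ha (n + 1)
    refine Real.ofDigits_lt_one hm (i := i - (n + 1)) ?_
    simpa [Nat.sub_add_cancel hi] using hi'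
  have h1 : Real.ofDigits a * (m : ℝ) ^ (n + 1) =
      ((K * m + a n : ℕ) : ℝ) + Real.ofDigits fun i => a (i + (n + 1)) := by
    rw [pow_succ, ← mul_assoc, hK, Real.ofDigits_eq_head_add fun i => a (i + n)]
    have e : (fun i => a (i + 1 + n)) = fun i => a (i + (n + 1)) := by
      funext i
      congr 1
      ring
    rw [e]
    push_cast
    field_simp
    simp
    ring
  have h2 : ⌊Real.ofDigits a * (m : ℝ) ^ (n + 1)⌋₊ = K * m + a n := by
    rw [Nat.floor_eq_iff (mul_nonneg (Real.ofDigits_nonneg a) (by positivity)), h1]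
    exact ⟨by linarith [Real.ofDigits_nonneg fun i => a (i + (n + 1))], by linarith⟩
  apply Fin.ext
  rw [Real.digits, h2]
  simp [Fin.ofNat, Nat.mod_eq_of_lt (a n).2]

/-! ### Billingsley's lemma -/

/-- The upper half of Billingsley's lemma. -/
theorem dimH_le_of_le_measure_cylinder {m : ℕ} [NeZero m] (hm : 1 < m) {Ω : Type*}
    [MeasurableSpace Ω] {μ : Measure Ω} [IsProbabilityMeasure μ] {X : ℕ → Ω → Fin m}
    (hX : ∀ n, Measurable (X n)) {S : Set ℝ} (hS : S ⊆ Set.Ico 0 1) {s : ℝ≥0}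
    (h : ∀ x ∈ S, ∀ᶠ n : ℕ in atTop,
      (m : ℝ) ^ (-((s : ℝ) * n)) ≤ μ.real {ω | ∀ i < n, X i ω = Real.digits x m i}) :
    dimH S ≤ s := by
  have hm0 : (0 : ℝ) < m := by positivity
  -- Countable stability of the dimension makes the threshold in `n` uniform.
  let B : ℕ → Set ℝ := fun N => {x | x ∈ S ∧ ∀ n, N ≤ n →
    (m : ℝ) ^ (-((s : ℝ) * n)) ≤ μ.real {ω | ∀ i < n, X i ω = Real.digits x m i}}
  have hSB : S ⊆ ⋃ N, B N := fun x hx => by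
    obtain ⟨N, hN⟩ := eventually_atTop.1 (h x hx)
    exact Set.mem_iUnion.2 ⟨N, hx, hN⟩
  refine (dimH_mono hSB).trans ?_
  rw [dimH_iUnion]
  refine iSup_le fun N => dimH_le_of_hausdorffMeasure_ne_top ?_
  let p : ∀ n, (Fin n → Fin m) → ℝ := fun n a => μ.real ((fun ω (i : Fin n) => X i ω) ⁻¹' {a})
  let r : ℕ → ℝ≥0∞ := fun n => ENNReal.ofReal (((m : ℝ) ^ n)⁻¹)
  have hr : Tendsto r atTop (𝓝 0) := by
    rw [← ENNReal.ofReal_zero]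
    refine ENNReal.tendsto_ofReal ?_
    simp_rw [← inv_pow]
    exact tendsto_pow_atTop_nhds_zero_of_lt_one (by positivity)
      (inv_lt_one_of_one_lt₀ (by exact_mod_cast hm))
  -- Cover by the heavy cylinders only: the `s`-th power of each diameter is at most the mass of the
  -- cylinder, so these powers sum to at most `1`.
  let t : ∀ n, {a : Fin n → Fin m // (m : ℝ) ^ (-((s : ℝ) * n)) ≤ p n a} → Set ℝ :=
    fun n a => {x | x ∈ Set.Ico (0 : ℝ) 1 ∧ ∀ i : Fin n, Real.digits x m i = a.1 i}
  have ht : ∀ n a, Metric.ediam (t n a) ≤ r n := by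
    intro n a
    refine Metric.ediam_le fun x hx y hy => ?_
    rw [edist_dist, Real.dist_eq, ← Real.ofDigits_digits hm hx.1, ← Real.ofDigits_digits hm hy.1]
    refine ENNReal.ofReal_le_ofReal (Real.abs_ofDigits_sub_ofDigits_le fun i hi => ?_)
    exact (hx.2 ⟨i, hi⟩).trans (hy.2 ⟨i, hi⟩).symm
  have hcov : ∀ᶠ n in atTop, B N ⊆ ⋃ a, t n a := by
    filter_upwards [eventually_ge_atTop N] with n hn x hx
    refine Set.mem_iUnion.2 ⟨⟨fun i => Real.digits x m i, ?_⟩, hS hx.1, fun i => rfl⟩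
    refine (hx.2 n hn).trans_eq ?_
    simp only [p]
    congr 1
    ext ω
    simp only [Set.mem_ofPred_eq, Set.mem_preimage, Set.mem_singleton_iff, funext_iff]
    exact ⟨fun h i => h i i.2, fun h i hi => h ⟨i, hi⟩⟩
  have hle := Measure.hausdorffMeasure_le_liminf_sum (s : ℝ) (B N) r hr t (Eventually.of_forall ht) hcov
  refine ((hle.trans ?_).trans_lt ENNReal.one_lt_top).ne
  refine (liminf_le_liminf (v := fun _ => (1 : ℝ≥0∞)) (Eventually.of_forall fun n => ?_)).trans_eq
    (liminf_const _)
  have hrs : r n ^ (s : ℝ) = ENNReal.ofReal ((m : ℝ) ^ (-((s : ℝ) * n))) := by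
    simp only [r]
    rw [ENNReal.ofReal_rpow_of_pos (by positivity), ← Real.rpow_natCast, ← Real.rpow_neg hm0.le,
      ← Real.rpow_mul hm0.le]
    congr 2
    ring
  have hmeas : Measurable fun ω (i : Fin n) => X i ω := measurable_pi_lambda _ fun i => hX i
  have hp1 : ∑ a, p n a = 1 := by
    have := sum_measureReal_preimage_singleton (μ := μ) (f := fun ω (i : Fin n) => X i ω)
      Finset.univ fun a _ => hmeas (measurableSet_singleton a)
    simpa using this
  calc ∑ a, Metric.ediam (t n a) ^ (s : ℝ)
      ≤ ∑ a : {a : Fin n → Fin m // (m : ℝ) ^ (-((s : ℝ) * n)) ≤ p n a},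
          ENNReal.ofReal (p n a) := by
        refine Finset.sum_le_sum fun a _ => ?_
        calc Metric.ediam (t n a) ^ (s : ℝ) ≤ r n ^ (s : ℝ) :=
              ENNReal.rpow_le_rpow (ht n a) s.2
          _ ≤ _ := hrs ▸ ENNReal.ofReal_le_ofReal a.2
    _ = ENNReal.ofReal (∑ a : {a : Fin n → Fin m // (m : ℝ) ^ (-((s : ℝ) * n)) ≤ p n a},
          p n a) := (ENNReal.ofReal_sum_of_nonneg fun a _ => measureReal_nonneg).symm
    _ ≤ 1 := by
        rw [ENNReal.ofReal_le_one, ← hp1, ← Finset.sum_subtype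
          (Finset.univ.filter fun a => (m : ℝ) ^ (-((s : ℝ) * n)) ≤ p n a) (by simp) (p n)]
        exact Finset.sum_le_sum_of_subset_of_nonneg (Finset.subset_univ _)
          fun a _ _ => measureReal_nonneg

/-- The lower half of Billingsley's lemma. -/
theorem le_dimH_of_measure_cylinder_le {m : ℕ} [NeZero m] (hm : 1 < m) {Ω : Type*}
    [MeasurableSpace Ω] {μ : Measure Ω} [IsProbabilityMeasure μ] {X : ℕ → Ω → Fin m}
    (hX : ∀ n, Measurable (X n)) {S : Set ℝ} (hS : S ⊆ Set.Ico 0 1) {s : ℝ≥0} (hs : 0 < s)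
    (hXS : ∀ᵐ ω ∂μ, Real.ofDigits (fun n => X n ω) ∈ S ∧
      Real.digits (Real.ofDigits fun n => X n ω) m = fun n => X n ω)
    (h : ∀ x ∈ S, ∀ᶠ n : ℕ in atTop,
      μ.real {ω | ∀ i < n, X i ω = Real.digits x m i} ≤ (m : ℝ) ^ (-((s : ℝ) * n))) :
    s ≤ dimH S := by
  have hm0 : (0 : ℝ) < m := by positivity
  have hm1 : (1 : ℝ) < m := by exact_mod_cast hm
  have hs' : (0 : ℝ) < s := hs
  let π : Ω → ℝ := fun ω => Real.ofDigits fun n => X n ω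
  have hπ : Measurable π :=
    Real.continuous_ofDigits.measurable.comp (measurable_pi_lambda _ hX)
  let ν : Measure ℝ := μ.map π
  let A : ℕ → Set ℝ := fun N => {x | x ∈ S ∧ ∀ n, N ≤ n →
    μ.real {ω | ∀ i < n, X i ω = Real.digits x m i} ≤ (m : ℝ) ^ (-((s : ℝ) * n))}
  have hSA : S ⊆ ⋃ N, A N := fun x hx => by
    obtain ⟨N, hN⟩ := eventually_atTop.1 (h x hx)
    exact Set.mem_iUnion.2 ⟨N, hx, hN⟩
  -- The sets `A N` need not be measurable; `ν (A N)` is an outer measure, and countable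
  -- subadditivity suffices.
  obtain ⟨N, hN⟩ : ∃ N, ν (A N) ≠ 0 := by
    by_contra! hcon
    have h1 : ν S = 0 := measure_mono_null hSA (measure_iUnion_null hcon)
    have h2 : μ (π ⁻¹' S) = 0 :=
      le_antisymm ((Measure.le_map_apply hπ.aemeasurable S).trans_eq h1) (zero_le)
    have h3 : ∀ᵐ ω ∂μ, False := by
      filter_upwards [hXS, measure_eq_zero_iff_ae_notMem.1 h2] with ω h4 h5
      exact h5 h4.1
    exact (IsProbabilityMeasure.ne_zero μ) (ae_eq_bot.1 (eventually_false_iff_eq_bot.1 h3))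
  refine le_trans ?_ (dimH_mono (fun x hx => hx.1 : A N ⊆ S))
  refine le_dimH_of_hausdorffMeasure_ne_zero fun h0 => hN ?_
  have hcyl : ∀ n, N ≤ n → ∀ k : ℕ, ν (A N ∩ {y | ⌊y * (m : ℝ) ^ n⌋₊ = k}) ≤
      ENNReal.ofReal ((m : ℝ) ^ (-((s : ℝ) * n))) := by
    intro n hn k
    rcases Set.eq_empty_or_nonempty (A N ∩ {y | ⌊y * (m : ℝ) ^ n⌋₊ = k}) with he | ⟨z, hzA, hz⟩
    · simp [he]
    have hmk : MeasurableSet {y : ℝ | ⌊y * (m : ℝ) ^ n⌋₊ = k} :=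
      (Nat.measurable_floor.comp (measurable_id.mul_const _)) (measurableSet_singleton k)
    calc ν (A N ∩ {y | ⌊y * (m : ℝ) ^ n⌋₊ = k}) ≤ ν {y | ⌊y * (m : ℝ) ^ n⌋₊ = k} :=
          measure_mono Set.inter_subset_right
      _ = μ (π ⁻¹' {y | ⌊y * (m : ℝ) ^ n⌋₊ = k}) := Measure.map_apply hπ hmk
      _ ≤ μ {ω | ∀ i < n, X i ω = Real.digits z m i} := by
          refine measure_mono_ae ?_
          filter_upwards [hXS] with ω hω hωk i hi
          have h1 : ⌊π ω * (m : ℝ) ^ n⌋₊ = ⌊z * (m : ℝ) ^ n⌋₊ := Eq.trans hωk hz.symm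
          rw [← Real.digits_eq_of_floor_eq h1 hi]
          exact (congrFun hω.2 i).symm
      _ = ENNReal.ofReal (μ.real {ω | ∀ i < n, X i ω = Real.digits z m i}) := by
          rw [ofReal_measureReal]
      _ ≤ _ := ENNReal.ofReal_le_ofReal (hzA.2 n hn)
  -- A set of diameter at most `m ^ (-n)` meets at most three neighbouring `m`-adic intervals. The
  -- closure provides the measurable set needed to evaluate the restriction to `A N`.
  have hsmall : ∀ n, N ≤ n → ∀ T : Set ℝ, Metric.ediam T ≤ ENNReal.ofReal (((m : ℝ) ^ n)⁻¹) →
      ν.restrict (A N) T ≤ 3 * ENNReal.ofReal ((m : ℝ) ^ (-((s : ℝ) * n))) := by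
    intro n hn T hT
    refine (measure_mono subset_closure).trans ?_
    rw [Measure.restrict_apply isClosed_closure.measurableSet]
    rw [← Metric.ediam_closure] at hT
    rcases Set.eq_empty_or_nonempty (closure T ∩ A N) with he | ⟨z, hzT, hzA⟩
    · simp [he]
    set k := ⌊z * (m : ℝ) ^ n⌋₊ with hk
    have hmn : (0 : ℝ) < (m : ℝ) ^ n := by positivity
    have hsub : closure T ∩ A N ⊆
        ⋃ j ∈ Finset.Icc (k - 1) (k + 1), A N ∩ {y | ⌊y * (m : ℝ) ^ n⌋₊ = j} := by
      rintro y ⟨hyT, hyA⟩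
      have hd : |y - z| ≤ ((m : ℝ) ^ n)⁻¹ := by
        have := (Metric.edist_le_ediam_of_mem hyT hzT).trans hT
        rw [edist_dist, Real.dist_eq] at this
        exact (ENNReal.ofReal_le_ofReal_iff (by positivity)).1 this
      have hd' : |y * (m : ℝ) ^ n - z * (m : ℝ) ^ n| ≤ 1 := by
        rw [← sub_mul, abs_mul, abs_of_pos hmn]
        calc _ ≤ ((m : ℝ) ^ n)⁻¹ * (m : ℝ) ^ n := by gcongr
          _ = 1 := inv_mul_cancel₀ hmn.ne'
      rw [abs_le] at hd'
      have hy0 : 0 ≤ y * (m : ℝ) ^ n := mul_nonneg (hS hyA.1).1 hmn.le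
      have hz0 : 0 ≤ z * (m : ℝ) ^ n := mul_nonneg (hS hzA.1).1 hmn.le
      have f1 := Nat.floor_le hy0
      have f2 := Nat.lt_floor_add_one (y * (m : ℝ) ^ n)
      have f3 := Nat.floor_le hz0
      have f4 := Nat.lt_floor_add_one (z * (m : ℝ) ^ n)
      have g1 : ⌊y * (m : ℝ) ^ n⌋₊ < k + 2 := by
        have : (⌊y * (m : ℝ) ^ n⌋₊ : ℝ) < k + 2 := by linarith
        exact_mod_cast this
      have g2 : k < ⌊y * (m : ℝ) ^ n⌋₊ + 2 := by
        have : (k : ℝ) < ⌊y * (m : ℝ) ^ n⌋₊ + 2 := by linarith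
        exact_mod_cast this
      simp only [Set.mem_iUnion, Finset.mem_Icc]
      exact ⟨⌊y * (m : ℝ) ^ n⌋₊, ⟨by lia, by lia⟩, hyA, rfl⟩
    calc ν (closure T ∩ A N)
        ≤ ∑ j ∈ Finset.Icc (k - 1) (k + 1), ν (A N ∩ {y | ⌊y * (m : ℝ) ^ n⌋₊ = j}) :=
          (measure_mono hsub).trans (measure_biUnion_finset_le _ _)
      _ ≤ ∑ j ∈ Finset.Icc (k - 1) (k + 1), ENNReal.ofReal ((m : ℝ) ^ (-((s : ℝ) * n))) :=
          Finset.sum_le_sum fun j _ => hcyl n hn j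
      _ ≤ 3 * ENNReal.ofReal ((m : ℝ) ^ (-((s : ℝ) * n))) := by
          rw [Finset.sum_const, nsmul_eq_mul]
          gcongr
          have : (Finset.Icc (k - 1) (k + 1)).card ≤ 3 := by
            rw [Nat.card_Icc]
            lia
          exact_mod_cast this
  -- The `3` counts intervals; `m ^ s` pays for rounding a diameter up to a power of `m`. With this
  -- `c` the mass distribution principle applies.
  set c : ℝ≥0∞ := 3 * ENNReal.ofReal ((m : ℝ) ^ (s : ℝ)) with hc
  have hc0 : c ≠ 0 := by
    simp only [hc, ne_eq, mul_eq_zero, ENNReal.ofReal_eq_zero, not_or, not_le]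
    exact ⟨by norm_num, by positivity⟩
  have hct : c ≠ ⊤ := ENNReal.mul_ne_top (by norm_num) ENNReal.ofReal_ne_top
  have hmass : ∀ T : Set ℝ, Metric.ediam T ≤ ENNReal.ofReal (((m : ℝ) ^ N)⁻¹) →
      ν.restrict (A N) T ≤ c * Metric.ediam T ^ (s : ℝ) := by
    intro T hT
    have hfin : Metric.ediam T ≠ ⊤ := ne_top_of_le_ne_top ENNReal.ofReal_ne_top hT
    have hpow : ∀ n : ℕ, (m : ℝ) ^ (-((s : ℝ) * n)) = (((m : ℝ) ^ n)⁻¹) ^ (s : ℝ) := by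
      intro n
      rw [← Real.rpow_natCast, ← Real.rpow_neg hm0.le, ← Real.rpow_mul hm0.le]
      congr 1
      ring
    rcases eq_or_ne (Metric.ediam T) 0 with hT0 | hT0
    · rw [hT0, ENNReal.zero_rpow_of_pos hs', mul_zero]
      have hlim : Tendsto (fun n : ℕ => 3 * ENNReal.ofReal ((m : ℝ) ^ (-((s : ℝ) * n)))) atTop
          (𝓝 0) := by
        have h1 : Tendsto (fun n : ℕ => (m : ℝ) ^ (-((s : ℝ) * n))) atTop (𝓝 0) := by
          have : ∀ n : ℕ, (m : ℝ) ^ (-((s : ℝ) * n)) = ((m : ℝ) ^ (-(s : ℝ))) ^ n := fun n => by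
            rw [← Real.rpow_natCast, ← Real.rpow_mul hm0.le, neg_mul]
          simp_rw [this]
          exact tendsto_pow_atTop_nhds_zero_of_lt_one (by positivity)
            (Real.rpow_lt_one_of_one_lt_of_neg hm1 (by linarith))
        have h2 := ENNReal.Tendsto.const_mul (a := 3) (ENNReal.tendsto_ofReal h1)
          (Or.inr (by norm_num))
        simpa using h2
      refine ge_of_tendsto hlim ?_
      filter_upwards [eventually_ge_atTop N] with n hn
      exact hsmall n hn T (by simp [hT0])
    · set D := (Metric.ediam T).toReal with hD
      have hD0 : 0 < D := ENNReal.toReal_pos hT0 hfin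
      have hDT : Metric.ediam T = ENNReal.ofReal D := (ENNReal.ofReal_toReal hfin).symm
      have hDN : D ≤ ((m : ℝ) ^ N)⁻¹ := by
        rw [hDT] at hT
        exact (ENNReal.ofReal_le_ofReal_iff (by positivity)).1 hT
      have hinv : 1 ≤ D⁻¹ := by
        refine (one_le_inv₀ hD0).2 (hDN.trans (inv_le_one_of_one_le₀ (one_le_pow₀ hm1.le)))
      obtain ⟨n, hn1, hn2⟩ := exists_nat_pow_near hinv hm1
      have hNn : N ≤ n := by
        have h1 : (m : ℝ) ^ N < (m : ℝ) ^ (n + 1) := by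
          refine lt_of_le_of_lt ?_ hn2
          rwa [le_inv_comm₀ (by positivity) hD0]
        have := (pow_lt_pow_iff_right₀ hm1).1 h1
        lia
      have hDn : D ≤ ((m : ℝ) ^ n)⁻¹ := by
        rwa [le_inv_comm₀ hD0 (by positivity)]
      have hnD : ((m : ℝ) ^ n)⁻¹ ≤ m * D := by
        have h1 : ((m : ℝ) ^ (n + 1))⁻¹ ≤ D := (inv_le_comm₀ hD0 (by positivity)).1 hn2.le
        rw [pow_succ, mul_inv, ← div_eq_mul_inv, div_le_iff₀ hm0] at h1
        linarith
      refine (hsmall n hNn T (hDT ▸ ENNReal.ofReal_le_ofReal hDn)).trans ?_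
      rw [hc, mul_assoc, hDT, ENNReal.ofReal_rpow_of_pos hD0,
        ← ENNReal.ofReal_mul (by positivity), ← Real.mul_rpow hm0.le hD0.le, hpow n]
      gcongr
  have hle : c⁻¹ • ν.restrict (A N) ≤ μH[(s : ℝ)] := by
    refine Measure.le_hausdorffMeasure _ _ (ENNReal.ofReal (((m : ℝ) ^ N)⁻¹))
      (ENNReal.ofReal_pos.2 (by positivity)) fun T hT => ?_
    rw [Measure.smul_apply, smul_eq_mul]
    calc c⁻¹ * ν.restrict (A N) T ≤ c⁻¹ * (c * Metric.ediam T ^ (s : ℝ)) := by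
          gcongr
          exact hmass T hT
      _ = Metric.ediam T ^ (s : ℝ) := by
          rw [← mul_assoc, ENNReal.inv_mul_cancel hc0 hct, one_mul]
  have h1 : c⁻¹ * ν.restrict (A N) (A N) = 0 := by
    have := Measure.le_iff'.1 hle (A N)
    rw [h0] at this
    exact le_antisymm this zero_le
  rw [Measure.restrict_apply_self] at h1
  exact (mul_eq_zero.1 h1).resolve_left (ENNReal.inv_ne_zero.2 hct)

/-! ### Cylinder masses and digit-pair frequencies -/

theorem IsMarkovChain.measureReal_cylinder {ι Ω : Type*} [DecidableEq ι] [MeasurableSpace ι]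
    [MeasurableSingletonClass ι] {mΩ : MeasurableSpace Ω} {μ : Measure Ω} {F : Filtration ℕ mΩ}
    {X : ℕ → Ω → ι} {Q : Matrix ι ι ℝ} {q : ι → ℝ} (h : IsMarkovChain μ F X Q q) (a : ℕ → ι)
    (n : ℕ) :
    μ.real {ω | ∀ i < n + 1, X i ω = a i} =
      q (a 0) * ∏ i ∈ Finset.range n, Q (a i) (a (i + 1)) := by
  let c : ℕ → Ω → ℝ := fun n ω => ∏ i ∈ Finset.range n, if X i ω = a i then 1 else 0
  have hcm : ∀ n, Measurable[F n] (c (n + 1)) := fun n =>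
    Finset.measurable_prod _ fun i hi =>
      h.measurable_ite (Nat.lt_succ_iff.1 (Finset.mem_range.1 hi)) _
  have hc01 : ∀ n ω, c n ω = if ∀ i < n, X i ω = a i then 1 else 0 := by
    intro n ω
    simp only [c]
    rw [Finset.prod_ite_zero]
    simp
  have hint : ∀ n, ∫ ω, c (n + 1) ω ∂μ = q (a 0) * ∏ i ∈ Finset.range n, Q (a i) (a (i + 1)) := by
    intro n
    induction n with
    | zero => simpa [c] using h.initial (a 0)
    | succ n ih =>
      have e1 : ∀ ω, c (n + 1) ω * (if X n ω = a n then 1 else 0) = c (n + 1) ω := by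
        intro ω
        simp only [c, Finset.prod_range_succ]
        split_ifs <;> simp
      have h1 := h.transition n (a n) (a (n + 1)) (c (n + 1)) (hcm n) fun ω => by
        rw [hc01]
        split_ifs <;> simp
      simp_rw [e1] at h1
      rw [ih] at h1
      have e2 : ∀ ω, c (n + 1 + 1) ω = c (n + 1) ω * (if X (n + 1) ω = a (n + 1) then 1 else 0) :=
        fun ω => Finset.prod_range_succ _ _
      simp_rw [e2]
      rw [h1, Finset.prod_range_succ]
      ring
  have hmeas : MeasurableSet {ω | ∀ i < n + 1, X i ω = a i} := by
    have : {ω | ∀ i < n + 1, X i ω = a i} = ⋂ i, ⋂ (_ : i < n + 1), X i ⁻¹' {a i} := by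
      ext ω
      simp
    rw [this]
    exact MeasurableSet.iInter fun i => MeasurableSet.iInter fun _ =>
      ((h.adapted i).mono (F.le i) le_rfl) (measurableSet_singleton _)
  rw [← hint, ← integral_indicator_one hmeas]
  congr 1
  funext ω
  rw [hc01, Set.indicator_apply]
  rfl

/-- Marginalisation of a product matrix to its first factor. -/
theorem sum_sum_prod_mul_apply {ι κ : Type*} [Fintype ι] [DecidableEq ι] [Fintype κ]
    [DecidableEq κ] {R : Matrix κ κ ℝ} (hR : ∑ i, ∑ j, R i j = 1) (φ : κ → κ → ℝ) (k₀ : ι) :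
    ∑ α : ι → κ, ∑ β : ι → κ, (∏ k, R (α k) (β k)) * φ (α k₀) (β k₀) =
      ∑ i, ∑ j, R i j * φ i j := by
  -- With `φ` absorbed into the factor `k₀` the sum over words is a product over coordinates, and
  -- all other factors sum to `1`.
  let g : ι → κ → κ → ℝ := fun k i j => R i j * if k = k₀ then φ i j else 1
  have h1 : ∀ α β : ι → κ, (∏ k, R (α k) (β k)) * φ (α k₀) (β k₀) = ∏ k, g k (α k) (β k) := by
    intro α β
    simp only [g]
    rw [Finset.prod_mul_distrib, Fintype.prod_ite_eq' k₀ fun k => φ (α k) (β k)]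
  have h2 : ∏ k, ∑ i, ∑ j, g k i j = ∑ α : ι → κ, ∑ β : ι → κ, ∏ k, g k (α k) (β k) := by
    rw [Finset.prod_univ_sum, Fintype.piFinset_univ]
    refine Finset.sum_congr rfl fun α _ => ?_
    rw [Finset.prod_univ_sum, Fintype.piFinset_univ]
  simp_rw [h1]
  rw [← h2, Finset.prod_eq_single k₀]
  · simp [g]
  · intro k _ hk
    simp [g, hk, hR]
  · simp

/-- If the frequencies of pairs of words are products, the pair frequencies of the sequence itself
are given by the factor. -/
theorem tendsto_average_of_wordFrequencies {κ : Type*} [Fintype κ] [DecidableEq κ] {ℓ : ℕ}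
    (hℓ : 0 < ℓ) {τ : Fin ℓ → ℕ → ℕ} (hτ : ∀ k : ℕ, 1 ≤ k → τ ⟨0, hℓ⟩ k = k) {R : Matrix κ κ ℝ}
    (hR : ∑ i, ∑ j, R i j = 1) {a : ℕ → κ}
    (ha : ∀ α β : Fin ℓ → κ, Tendsto (fun n : ℕ => (((Finset.Icc 1 n).filter fun k =>
      (fun i => a (τ i k)) = α ∧ (fun i => a (τ i k + 1)) = β).card : ℝ) / n) atTop
      (𝓝 (∏ i, R (α i) (β i)))) (φ : κ → κ → ℝ) :
    Tendsto (fun n : ℕ => (∑ k ∈ Finset.range (n + 1), φ (a k) (a (k + 1))) / n) atTop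
      (𝓝 (∑ i, ∑ j, R i j * φ i j)) := by
  rw [← sum_sum_prod_mul_apply hR φ (⟨0, hℓ⟩ : Fin ℓ)]
  -- Counting starts at `k = 1`, while cylinders start at digit `0`; the missing pair disappears
  -- after division by `n`.
  have h1 : Tendsto (fun n : ℕ => φ (a 0) (a 1) / n + ∑ α : Fin ℓ → κ, ∑ β : Fin ℓ → κ,
      (((Finset.Icc 1 n).filter fun k =>
        (fun i => a (τ i k)) = α ∧ (fun i => a (τ i k + 1)) = β).card : ℝ) / n *
        φ (α ⟨0, hℓ⟩) (β ⟨0, hℓ⟩)) atTop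
      (𝓝 (0 + ∑ α : Fin ℓ → κ, ∑ β : Fin ℓ → κ, (∏ k, R (α k) (β k)) *
        φ (α ⟨0, hℓ⟩) (β ⟨0, hℓ⟩))) :=
    (tendsto_const_div_atTop_nhds_zero_nat _).add (tendsto_finsetSum _ fun α _ =>
      tendsto_finsetSum _ fun β _ => (ha α β).mul_const _)
  rw [zero_add] at h1
  refine h1.congr fun n => ?_
  have e : ∑ k ∈ Finset.range (n + 1), φ (a k) (a (k + 1)) =
      φ (a 0) (a 1) + ∑ k ∈ Finset.Icc 1 n, φ (a k) (a (k + 1)) := by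
    rw [Finset.range_eq_Ico, Finset.sum_eq_sum_Ico_succ_bot (Nat.succ_pos n)]
    rfl
  rw [e, add_div]
  congr 1
  simp_rw [div_mul_eq_mul_div, ← Finset.sum_div]
  congr 1
  simp_rw [Finset.card_filter, Nat.cast_sum, Finset.sum_mul]
  have e2 : ∀ α : Fin ℓ → κ, ∑ β : Fin ℓ → κ, ∑ k ∈ Finset.Icc 1 n,
      ((if (fun i => a (τ i k)) = α ∧ (fun i => a (τ i k + 1)) = β then 1 else 0 : ℕ) : ℝ) *
        φ (α ⟨0, hℓ⟩) (β ⟨0, hℓ⟩) = ∑ k ∈ Finset.Icc 1 n, ∑ β : Fin ℓ → κ,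
      ((if (fun i => a (τ i k)) = α ∧ (fun i => a (τ i k + 1)) = β then 1 else 0 : ℕ) : ℝ) *
        φ (α ⟨0, hℓ⟩) (β ⟨0, hℓ⟩) := fun α => Finset.sum_comm
  simp_rw [e2]
  rw [Finset.sum_comm]
  refine Finset.sum_congr rfl fun k hk => ?_
  rw [Finset.sum_eq_single fun i => a (τ i k), Finset.sum_eq_single fun i => a (τ i k + 1)]
  · simp [hτ k (Finset.mem_Icc.1 hk).1]
  · intro β _ hβ
    simp [hβ.symm]
  · simp
  · intro α _ hα
    simp [hα.symm]
  · simp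

/-- A sequence in which not all of the mass sits on `c` is not eventually equal to `c`. -/
theorem exists_ge_ne_of_tendsto_average {κ : Type*} [Fintype κ] [DecidableEq κ] {R : Matrix κ κ ℝ}
    {a : ℕ → κ} (ha : ∀ φ : κ → κ → ℝ,
      Tendsto (fun n : ℕ => (∑ k ∈ Finset.range (n + 1), φ (a k) (a (k + 1))) / n) atTop
        (𝓝 (∑ i, ∑ j, R i j * φ i j)))
    (hR : ∀ i, 0 < ∑ j, R i j) {c d : κ} (hcd : d ≠ c) (n : ℕ) : ∃ i, n ≤ i ∧ a i ≠ c := by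
  by_contra! hcon
  -- The indicator of `i ≠ c` would have average `0`, yet its limit is at least the mass of row `d`.
  have h1 := ha fun i _ => if i = c then 0 else 1
  have h2 : Tendsto (fun n : ℕ => (∑ k ∈ Finset.range (n + 1),
      (if a k = c then 0 else 1 : ℝ)) / n) atTop (𝓝 0) := by
    refine squeeze_zero (fun k => by positivity) (fun k => ?_)
      (tendsto_const_div_atTop_nhds_zero_nat (n : ℝ))
    gcongr
    calc ∑ k ∈ Finset.range (k + 1), (if a k = c then 0 else 1 : ℝ)
        = (((Finset.range (k + 1)).filter fun i => a i ≠ c).card : ℝ) := by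
          rw [Finset.card_filter]
          push_cast
          exact Finset.sum_congr rfl fun i _ => by by_cases hi : a i = c <;> simp [hi]
      _ ≤ ((Finset.range n).card : ℝ) := by
          norm_cast
          refine Finset.card_le_card fun i hi => ?_
          rw [Finset.mem_filter] at hi
          rw [Finset.mem_range]
          by_contra hni
          exact hi.2 (hcon i (not_lt.1 hni))
      _ = n := by simp
  have h3 := tendsto_nhds_unique h1 h2
  have h4 : ∑ i, ∑ j, R i j * (if i = c then 0 else 1 : ℝ) =
      ∑ i, if i = c then 0 else ∑ j, R i j := by
    refine Finset.sum_congr rfl fun i _ => ?_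
    rw [← Finset.sum_mul]
    split_ifs <;> simp
  rw [h4] at h3
  have h5 := (Finset.sum_eq_zero_iff_of_nonneg fun i _ => by
    split_ifs
    · exact le_rfl
    · exact (hR i).le).1 h3 d (Finset.mem_univ d)
  rw [if_neg hcd] at h5
  exact (hR d).ne' h5

theorem eventually_of_forall_add_two {p : ℕ → Prop} (h : ∀ᶠ n in atTop, p (n + 2)) :
    ∀ᶠ n in atTop, p n := by
  obtain ⟨N, hN⟩ := eventually_atTop.1 h
  refine eventually_atTop.2 ⟨N + 2, fun n hn => ?_⟩
  obtain ⟨k, rfl⟩ : ∃ k, n = k + 2 := ⟨n - 2, by lia⟩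
  exact hN k (by lia)

/-- A word of length `n + 2` has `n + 1` transitions; this absorbs the shift between the two counts
and the constant from the initial law. -/
theorem tendsto_mul_add_two_div_add {T : ℕ → ℝ} {L : ℝ}
    (hT : Tendsto (fun n : ℕ => T n / n) atTop (𝓝 L)) (c b : ℝ) :
    Tendsto (fun n : ℕ => (T n + c * (n + 2) + b) / n) atTop (𝓝 (L + c)) := by
  have h1 := (hT.add_const c).add (tendsto_const_div_atTop_nhds_zero_nat (2 * c + b))
  rw [add_zero] at h1
  refine h1.congr' ?_
  filter_upwards [eventually_ge_atTop 1] with n hn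
  have : (n : ℝ) ≠ 0 := by positivity
  field_simp
  ring

/-! ### The two entropy bounds -/

theorem dimH_le_of_entropy_lt {m : ℕ} [NeZero m] (hm : 1 < m) {Q : Matrix (Fin m) (Fin m) ℝ}
    (hQ : Q ∈ Matrix.rowStochastic ℝ (Fin m)) {q : Fin m → ℝ} (hq : ∀ i, 0 ≤ q i)
    (hq1 : ∑ i, q i = 1) {S : Set ℝ} (hS : S ⊆ Set.Ico 0 1)
    (hfreq : ∀ x ∈ S, ∀ φ : Fin m → Fin m → ℝ, Tendsto (fun n : ℕ =>
      (∑ k ∈ Finset.range (n + 1), φ (Real.digits x m k) (Real.digits x m (k + 1))) / n) atTop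
      (𝓝 (∑ i, ∑ j, q i * Q i j * φ i j)))
    {s : ℝ≥0} (hs : -∑ i, ∑ j, q i * Q i j * Real.log (Q i j) < s * Real.log m) :
    dimH S ≤ s := by
  have hm0 : (0 : ℝ) < m := by positivity
  have hQ0 : ∀ i j, 0 ≤ Q i j := fun i j => Matrix.nonneg_of_mem_rowStochastic hQ
  set H := -∑ i, ∑ j, q i * Q i j * Real.log (Q i j) with hH
  set g := s * Real.log m - H with hg
  have hg0 : 0 < g := sub_pos.2 hs
  -- Since `Q' ≥ θ * Q`, the perturbation costs at most `-log θ = g / 2`, half of the available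
  -- margin `g`.
  set θ := Real.exp (-(g / 2)) with hθ
  have hθ0 : 0 < θ := Real.exp_pos _
  have hθ1 : θ < 1 := by
    rw [hθ, ← Real.exp_zero]
    exact Real.exp_lt_exp.2 (by linarith)
  let Q' : Matrix (Fin m) (Fin m) ℝ := fun i j => θ * Q i j + (1 - θ) * (m : ℝ)⁻¹
  have hQ'θ : ∀ i j, θ * Q i j < Q' i j := fun i j => by
    have : 0 < (1 - θ) * (m : ℝ)⁻¹ := mul_pos (by linarith) (by positivity)
    simp only [Q']
    linarith
  have hQ'0 : ∀ i j, 0 < Q' i j := fun i j =>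
    (mul_nonneg hθ0.le (hQ0 i j)).trans_lt (hQ'θ i j)
  have hQ' : Q' ∈ Matrix.rowStochastic ℝ (Fin m) := by
    rw [Matrix.mem_rowStochastic_iff_sum]
    refine ⟨fun i j => (hQ'0 i j).le, fun i => ?_⟩
    simp only [Q', Finset.sum_add_distrib, ← Finset.mul_sum,
      Matrix.sum_row_of_mem_rowStochastic hQ, Finset.sum_const, Finset.card_univ, Fintype.card_fin,
      nsmul_eq_mul]
    field_simp
    ring
  obtain ⟨Ω, mΩ, μ, F, X, hμ, hX⟩ := exists_isMarkovChain hQ' (q := fun _ => (m : ℝ)⁻¹)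
    (fun _ => by positivity) (by simp [hm0.ne'])
  have hL : -H - g / 2 ≤ ∑ i, ∑ j, q i * Q i j * Real.log (Q' i j) := by
    have h1 : -H - g / 2 = ∑ i, ∑ j, q i * Q i j * (Real.log (Q i j) + Real.log θ) := by
      simp only [mul_add, Finset.sum_add_distrib, ← Finset.sum_mul, ← Finset.mul_sum,
        Matrix.sum_row_of_mem_rowStochastic hQ, mul_one, hq1, hθ, Real.log_exp, hH]
      ring
    rw [h1]
    refine Finset.sum_le_sum fun i _ => Finset.sum_le_sum fun j _ => ?_
    rcases (hQ0 i j).eq_or_lt with h0 | h0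
    · simp [← h0]
    · refine mul_le_mul_of_nonneg_left ?_ (mul_nonneg (hq i) (hQ0 i j))
      rw [← Real.log_mul h0.ne' hθ0.ne', mul_comm]
      exact Real.log_le_log (mul_pos hθ0 h0) (hQ'θ i j).le
  refine dimH_le_of_le_measure_cylinder (μ := μ) (X := X) hm (fun n => (hX.adapted n).mono (F.le n) le_rfl) hS
    fun x hx => eventually_of_forall_add_two ?_
  have hlim := tendsto_mul_add_two_div_add (hfreq x hx fun i j => Real.log (Q' i j))
    (s * Real.log m) (-Real.log m)
  have hpos : 0 < ∑ i, ∑ j, q i * Q i j * Real.log (Q' i j) + s * Real.log m := by linarith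
  filter_upwards [hlim.eventually_const_lt hpos, eventually_ge_atTop 1] with n hn hn1
  have hn0 : (0 : ℝ) < n := by exact_mod_cast hn1
  rw [lt_div_iff₀ hn0, zero_mul] at hn
  rw [hX.measureReal_cylinder _ (n + 1)]
  have e : (m : ℝ)⁻¹ * ∏ i ∈ Finset.range (n + 1),
      Q' (Real.digits x m i) (Real.digits x m (i + 1)) =
      Real.exp (-Real.log m + ∑ i ∈ Finset.range (n + 1),
        Real.log (Q' (Real.digits x m i) (Real.digits x m (i + 1)))) := by
    rw [Real.exp_add, Real.exp_neg, Real.exp_log hm0, Real.exp_sum]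
    congr 1
    exact Finset.prod_congr rfl fun i _ => (Real.exp_log (hQ'0 _ _)).symm
  rw [e, Real.rpow_def_of_pos hm0]
  refine Real.exp_le_exp.2 ?_
  push_cast
  linarith

theorem le_dimH_of_lt_entropy {m : ℕ} [NeZero m] (hm : 1 < m) {Ω : Type*} {mΩ : MeasurableSpace Ω}
    {μ : Measure Ω} [IsProbabilityMeasure μ] {F : Filtration ℕ mΩ} {X : ℕ → Ω → Fin m}
    {Q : Matrix (Fin m) (Fin m) ℝ} {q : Fin m → ℝ} (hX : IsMarkovChain μ F X Q q)
    (hQ : Q ∈ Matrix.rowStochastic ℝ (Fin m)) (hq : ∀ i, 0 ≤ q i) (hq1 : ∑ i, q i = 1)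
    {S : Set ℝ} (hS : S ⊆ Set.Ico 0 1)
    (hfreq : ∀ x ∈ S, ∀ φ : Fin m → Fin m → ℝ, Tendsto (fun n : ℕ =>
      (∑ k ∈ Finset.range (n + 1), φ (Real.digits x m k) (Real.digits x m (k + 1))) / n) atTop
      (𝓝 (∑ i, ∑ j, q i * Q i j * φ i j)))
    (hXS : ∀ᵐ ω ∂μ, Real.ofDigits (fun n => X n ω) ∈ S ∧
      Real.digits (Real.ofDigits fun n => X n ω) m = fun n => X n ω)
    {s : ℝ≥0} (hs0 : 0 < s) (hs : s * Real.log m < -∑ i, ∑ j, q i * Q i j * Real.log (Q i j)) :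
    s ≤ dimH S := by
  have hm0 : (0 : ℝ) < m := by positivity
  have hQ0 : ∀ i j, 0 ≤ Q i j := fun i j => Matrix.nonneg_of_mem_rowStochastic hQ
  refine le_dimH_of_measure_cylinder_le hm (fun n => (hX.adapted n).mono (F.le n) le_rfl) hS hs0
    hXS fun x hx => eventually_of_forall_add_two ?_
  have hlim := tendsto_mul_add_two_div_add (hfreq x hx fun i j => Real.log (Q i j))
    (s * Real.log m) 0
  have hneg : ∑ i, ∑ j, q i * Q i j * Real.log (Q i j) + s * Real.log m < 0 := by linarith
  filter_upwards [hlim.eventually_lt_const hneg, eventually_ge_atTop 1] with n hn hn1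
  have hn0 : (0 : ℝ) < n := by exact_mod_cast hn1
  rw [div_lt_iff₀ hn0, zero_mul] at hn
  rw [hX.measureReal_cylinder _ (n + 1), Real.rpow_def_of_pos hm0]
  have hqle : q (Real.digits x m 0) ≤ 1 :=
    hq1 ▸ Finset.single_le_sum (fun j _ => hq j) (Finset.mem_univ _)
  calc q (Real.digits x m 0) * ∏ i ∈ Finset.range (n + 1),
        Q (Real.digits x m i) (Real.digits x m (i + 1))
      ≤ ∏ i ∈ Finset.range (n + 1), Q (Real.digits x m i) (Real.digits x m (i + 1)) :=
        mul_le_of_le_one_left (Finset.prod_nonneg fun i _ => hQ0 _ _) hqle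
    -- This holds also where `Q` vanishes: `Real.log 0 = 0` makes the right side `1`.
    _ ≤ ∏ i ∈ Finset.range (n + 1),
        Real.exp (Real.log (Q (Real.digits x m i) (Real.digits x m (i + 1)))) :=
        Finset.prod_le_prod (fun i _ => hQ0 _ _) fun i _ => Real.le_exp_log _
    _ = Real.exp (∑ i ∈ Finset.range (n + 1),
        Real.log (Q (Real.digits x m i) (Real.digits x m (i + 1)))) := (Real.exp_sum _ _).symm
    _ ≤ _ := by
        refine Real.exp_le_exp.2 ?_
        push_cast
        linarith

/-! ### Dimension of the prescribed frequency set -/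

theorem IsSamplingFamily.exists_gap {ℓ : ℕ} {τ : Fin ℓ → ℕ → ℕ} (hτ : IsSamplingFamily τ) :
    ∃ ε : ℝ, 0 < ε ∧ ε ≤ 1 ∧ (∀ i n, 1 ≤ n → τ i n < τ i (n + 1)) ∧
      ∀ i j, i < j → ∀ n : ℕ, 1 ≤ n → (τ i n : ℝ) + ε * n ≤ τ j n := by
  obtain ⟨-, ε, hε0, hε1, hgap, hstep⟩ := hτ
  refine ⟨ε, hε0, hε1, fun i n hn => ?_, fun i j hij n hn => ?_⟩
  · have := hstep i n hn
    have h1 : (τ i n : ℝ) < τ i (n + 1) := by linarith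
    exact_mod_cast h1
  · have key : ∀ d : ℕ, ∀ h : (i : ℕ) + d + 1 < ℓ,
        (τ i n : ℝ) + ε * n ≤ τ ⟨(i : ℕ) + d + 1, h⟩ n := by
      intro d
      induction d with
      | zero => exact fun h => hgap i ⟨_, h⟩ rfl n hn
      | succ d ih =>
        intro h
        have h1 := ih (by lia)
        have h2 := hgap ⟨(i : ℕ) + d + 1, by lia⟩ ⟨(i : ℕ) + (d + 1) + 1, h⟩ (by simp; lia) n hn
        have h3 : 0 ≤ ε * n := by positivity
        linarith
    have hij' : (i : ℕ) < j := hij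
    have h1 := key (j - i - 1) (by have := j.2; lia)
    have e : (⟨(i : ℕ) + (j - i - 1) + 1, by have := j.2; lia⟩ : Fin ℓ) = j :=
      Fin.ext (by simp; lia)
    rwa [e] at h1

theorem pairCount_ofDigits {m ℓ : ℕ} [NeZero m] (τ : Fin ℓ → ℕ → ℕ) (α β : Fin ℓ → Fin m)
    {a : ℕ → Fin m} (ha : Real.digits (Real.ofDigits a) m = a) (n : ℕ) :
    pairCount τ α β (Real.ofDigits a) n = ((Finset.Icc 1 n).filter fun k =>
      (fun i => a (τ i k)) = α ∧ (fun i => a (τ i k + 1)) = β).card := by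
  rw [pairCount, ha]

theorem sum_prod_ite_eq_card {κ : Type*} [DecidableEq κ] {ℓ : ℕ} (τ : Fin ℓ → ℕ → ℕ)
    (α β : Fin ℓ → κ) (a : ℕ → κ) (n : ℕ) :
    ∑ k ∈ Finset.Icc 1 n, ∏ i, ((if a (τ i k) = α i then 1 else 0) *
      (if a (τ i k + 1) = β i then 1 else 0) : ℝ) = (((Finset.Icc 1 n).filter fun k =>
      (fun i => a (τ i k)) = α ∧ (fun i => a (τ i k + 1)) = β).card : ℝ) := by
  rw [Finset.card_filter, Nat.cast_sum]
  refine Finset.sum_congr rfl fun k _ => ?_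
  rw [Finset.prod_mul_distrib, Finset.prod_ite_zero, Finset.prod_ite_zero]
  simp [funext_iff, ← ite_and, and_comm]

theorem dimH_prescribedFrequencySet {m ℓ : ℕ} [NeZero m] (hm : 1 < m) (hℓ : 0 < ℓ)
    {τ : Fin ℓ → ℕ → ℕ} (hτ : IsSamplingFamily τ) (hτ_first : ∀ k : ℕ, 1 ≤ k → τ ⟨0, hℓ⟩ k = k)
    {P : Matrix (Fin ℓ → Fin m) (Fin ℓ → Fin m) ℝ} {Q : Matrix (Fin m) (Fin m) ℝ}
    (hQ : Q ∈ Matrix.rowStochastic ℝ (Fin m)) {q : Fin m → ℝ} (hq : ∀ i, 0 < q i)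
    (hq1 : ∑ i, q i = 1) {C ρ : ℝ} (hC : 0 < C) (hρ0 : 0 < ρ) (hρ1 : ρ < 1)
    (hmix : ∀ d i j, |(Q ^ d) i j - q j| ≤ C * ρ ^ d)
    (hP : ∀ α β, P α β = ∏ i, q (α i) * Q (α i) (β i)) :
    dimH (prescribedFrequencySet τ P) =
      ENNReal.ofReal ((-∑ i, ∑ j, q i * Q i j * Real.log (Q i j)) / Real.log m) := by
  have hlog : 0 < Real.log m := Real.log_pos (by exact_mod_cast hm)
  let R : Matrix (Fin m) (Fin m) ℝ := fun i j => q i * Q i j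
  have hRrow : ∀ i, ∑ j, R i j = q i := fun i => by
    simp only [R, ← Finset.mul_sum, Matrix.sum_row_of_mem_rowStochastic hQ, mul_one]
  have hR1 : ∑ i, ∑ j, R i j = 1 := by simp_rw [hRrow, hq1]
  have hS : prescribedFrequencySet τ P ⊆ Set.Ico 0 1 := fun x hx => ⟨hx.1.1.le, hx.1.2⟩
  have hfreq : ∀ x ∈ prescribedFrequencySet τ P, ∀ φ : Fin m → Fin m → ℝ, Tendsto (fun n : ℕ =>
      (∑ k ∈ Finset.range (n + 1), φ (Real.digits x m k) (Real.digits x m (k + 1))) / n) atTop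
      (𝓝 (∑ i, ∑ j, q i * Q i j * φ i j)) := fun x hx φ =>
    tendsto_average_of_wordFrequencies hℓ hτ_first (R := R) hR1 (fun α β => by
      have := hx.2 α β
      rwa [hP] at this) φ
  refine le_antisymm ?_ ?_
  · refine le_of_forall_gt_imp_ge_of_dense fun r hr => ?_
    induction r with
    | top => exact le_top
    | coe s =>
      refine dimH_le_of_entropy_lt hm hQ (fun i => (hq i).le) hq1 hS hfreq ?_
      rw [ENNReal.ofReal, ENNReal.coe_lt_coe] at hr
      exact (div_lt_iff₀ hlog).1 ((Real.le_coe_toNNReal _).trans_lt (NNReal.coe_lt_coe.2 hr))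
  · refine ENNReal.le_of_forall_nnreal_lt fun s hs => ?_
    -- The mass distribution argument needs a positive exponent.
    rcases eq_or_ne s 0 with rfl | hs0
    · simp
    obtain ⟨Ω, mΩ, μ, F, X, hμ, hX⟩ := exists_isMarkovChain hQ (fun i => (hq i).le) hq1
    obtain ⟨ε, hε0, hε1, hstep, hgap⟩ := hτ.exists_gap
    refine le_dimH_of_lt_entropy hm hX hQ (fun i => (hq i).le) hq1 hS hfreq ?_
      (pos_iff_ne_zero.2 hs0) ?_
    · have hae : ∀ᵐ ω ∂μ, ∀ α β : Fin ℓ → Fin m, _ := ae_all_iff.2 fun α => ae_all_iff.2 fun β =>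
        hX.ae_tendsto_average_prod hQ (fun i => (hq i).le) hq1 hC hρ0 hρ1 hmix hε0 hε1 τ hstep
          hgap α β
      filter_upwards [hae] with ω hω
      have hcard : ∀ α β : Fin ℓ → Fin m, Tendsto (fun n : ℕ => (((Finset.Icc 1 n).filter fun k =>
          (fun i => X (τ i k) ω) = α ∧ (fun i => X (τ i k + 1) ω) = β).card : ℝ) / n) atTop
          (𝓝 (∏ i, R (α i) (β i))) := by
        intro α β
        refine (hω α β).congr fun n => ?_
        rw [sum_prod_ite_eq_card τ α β fun k => X k ω]
      -- Every digit has positive frequency, so almost no path is eventually constant: its value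
      -- lies in `(0, 1)` and has the path as its digits.
      have hne : ∀ c d : Fin m, d ≠ c → ∀ n, ∃ i, n ≤ i ∧ X i ω ≠ c := fun c d hcd =>
        exists_ge_ne_of_tendsto_average (a := fun k => X k ω)
          (tendsto_average_of_wordFrequencies hℓ hτ_first hR1 hcard)
          (fun i => (hRrow i).symm ▸ hq i) hcd
      have hdig : Real.digits (Real.ofDigits fun n => X n ω) m = fun n => X n ω := by
        refine Real.digits_ofDigits hm fun n => ?_
        obtain ⟨i, hi, hi'⟩ := hne ⟨m - 1, by lia⟩ ⟨0, by lia⟩ (by simp [Fin.ext_iff]; lia) n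
        exact ⟨i, hi, fun h => hi' (Fin.ext h)⟩
      refine ⟨⟨⟨?_, ?_⟩, fun α β => ?_⟩, hdig⟩
      · obtain ⟨i, -, hi⟩ := hne ⟨0, by lia⟩ ⟨1, hm⟩ (by simp [Fin.ext_iff]) 0
        exact Real.ofDigits_pos hm (i := i) fun h => hi (Fin.ext h)
      · obtain ⟨i, -, hi⟩ := hne ⟨m - 1, by lia⟩ ⟨0, by lia⟩ (by simp [Fin.ext_iff]; lia) 0
        exact Real.ofDigits_lt_one hm (i := i) fun h => hi (Fin.ext h)
      · rw [hP]
        simp_rw [pairCount_ofDigits τ α β hdig]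
        exact hcard α β
    · rw [ENNReal.ofReal, ENNReal.coe_lt_coe] at hs
      exact (lt_div_iff₀ hlog).1 (Real.lt_toNNReal_iff_coe_lt.1 hs)

theorem proposition2p7
    (m ℓ : ℕ) [NeZero m] (hm : 1 < m) (hℓ : 0 < ℓ)
    (τ : Fin ℓ → ℕ → ℕ) (hτ : IsSamplingFamily τ) (hτ_first : ∀ k : ℕ, 1 ≤ k → τ ⟨0, hℓ⟩ k = k)
    (P : Matrix (Fin ℓ → Fin m) (Fin ℓ → Fin m) ℝ)
    (R : Matrix (Fin m) (Fin m) ℝ)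
    (hR_nonneg : ∀ i j, 0 ≤ R i j)
    (hR_pow : ∃ n : ℕ, 1 ≤ n ∧ ∀ i j, 0 < (R ^ n) i j)
    (hR_sum : ∑ i, ∑ j, R i j = 1)
    (q : Fin m → ℝ)
    (hq_row : ∀ i, q i = ∑ j, R i j) (hq_col : ∀ i, q i = ∑ j, R j i)
    (hP : ∀ α β, P α β = ∏ i, R (α i) (β i))
    (Q : Matrix (Fin m) (Fin m) ℝ) (hQ : ∀ i j, Q i j = (q i)⁻¹ * R i j) :
    -- `Q` is an irreducible aperiodic probability matrix
    Q ∈ Matrix.rowStochastic ℝ (Fin m) ∧ Q.IsIrreducible ∧ IsAperiodicMatrix Q ∧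
    -- `q` is a positive stationary probability vector of `Q`, and the only one
    (∀ i, 0 < q i) ∧ ∑ i, q i = 1 ∧ Matrix.vecMul q Q = q ∧
    (∀ v : Fin m → ℝ, (∀ i, 0 ≤ v i) → ∑ i, v i = 1 → Matrix.vecMul v Q = v → v = q) ∧
    -- the Hausdorff dimension, as an equality of extended reals
    (dimH (prescribedFrequencySet τ P) : EReal) =
      (((-∑ i, ∑ j, q i * Q i j * Real.log (Q i j)) / Real.log m : ℝ) : EReal) := by
  obtain ⟨N, hN, hRN⟩ := hR_pow
  have hq0 : ∀ i, 0 < q i := fun i => hq_row i ▸ sum_row_pos_of_pow_pos hR_nonneg hN hRN i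
  have hq1 : ∑ i, q i = 1 := by simp_rw [hq_row, hR_sum]
  have hRQ : ∀ i j, q i * Q i j = R i j := fun i j => by
    rw [hQ, mul_inv_cancel_left₀ (hq0 i).ne']
  have hQ0 : ∀ i j, 0 ≤ Q i j := fun i j =>
    hQ i j ▸ mul_nonneg (inv_nonneg.2 (hq0 i).le) (hR_nonneg i j)
  have hQs : Q ∈ Matrix.rowStochastic ℝ (Fin m) := by
    rw [Matrix.mem_rowStochastic_iff_sum]
    refine ⟨hQ0, fun i => ?_⟩
    simp_rw [hQ, ← Finset.mul_sum, ← hq_row]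
    exact inv_mul_cancel₀ (hq0 i).ne'
  -- As `q i ≤ 1`, positivity of `R ^ N` passes to `Q ^ N`.
  have hRleQ : ∀ i j, R i j ≤ Q i j := fun i j => by
    rw [← hRQ]
    exact mul_le_of_le_one_left (hQ0 i j)
      (hq1 ▸ Finset.single_le_sum (fun k _ => (hq0 k).le) (Finset.mem_univ i))
  have hQN : ∀ i j, 0 < (Q ^ N) i j := fun i j =>
    (hRN i j).trans_le (pow_apply_le_pow_apply hR_nonneg hRleQ N i j).2
  have hstat : Matrix.vecMul q Q = q := by
    funext j
    simp only [Matrix.vecMul, dotProduct, hRQ]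
    exact (hq_col j).symm
  obtain ⟨C, ρ, hC, hρ0, hρ1, hmix⟩ :=
    exists_geometric_mixing hQs (fun i => (hq0 i).le) hq1 hstat hN hQN
  refine ⟨hQs, (Matrix.IsPrimitive.mk hQ0 ⟨N, hN, hQN⟩).isIrreducible,
    isAperiodicMatrix_of_pow_pos hQs hN hQN, hq0, hq1, hstat,
    fun v _ hv1 hv => eq_of_geometric_mixing hρ0 hρ1 hmix hv1 hv, ?_⟩
  rw [dimH_prescribedFrequencySet hm hℓ hτ hτ_first hQs hq0 hq1 hC hρ0 hρ1 hmix
    (fun α β => by simp_rw [hP, hRQ]), EReal.coe_ennreal_ofReal, max_eq_left]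
  -- Nonnegativity of the entropy makes the truncation in `ENNReal.ofReal` harmless.
  refine div_nonneg ?_ (Real.log_natCast_nonneg m)
  rw [neg_nonneg]
  exact Finset.sum_nonpos fun i _ => Finset.sum_nonpos fun j _ =>
    mul_nonpos_of_nonneg_of_nonpos (mul_nonneg (hq0 i).le (hQ0 i j))
      (Real.log_nonpos (hQ0 i j) (Matrix.le_one_of_mem_rowStochastic hQs))
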